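/- **Proposition 6.5.** Let $\mathbb K$ be a field of characteristic zero. *The algebra $\mathcal A(P)$.* Let $\mathcal A(P)$ be the $\mathbb K$-vector space with basis $P_{m_1\dots m_k}$ ($k\ge 1$, $m_i\ge 1$), with the associative products determined on the basis by $$P_{m_1\dots m_k}\prec P_{n_1\dots n_l}=P_{m_1\dots m_k n_1\dots n_l},\qquad P_{m_1\dots m_k}\bullet P_{n_1\dots n_l}=P_{m_1\dots m_{k-1}\,(m_k+n_1)\,n_2\dots n_l},$$ and $\alpha\succ\beta:=\alpha\prec\beta+\alpha\bullet\beta$. Thus, with $P:=P_1$, $P_n=P^{\bullet n}$ and $P_{m_1\dots m_k}=P_{m_1}\prec\dots\prec P_{m_k}$. The main (shuffle) product $\circ$ is the bilinear product with $$P_{m_1\dots m_k}\circ P_{m_{k+1}\dots m_{k+l}}=\sum_{\sigma\in\mathrm{Shuff}(k,l)}P_{m_{\sigma(1)}}\curlywedge_{\sigma,1}P_{m_{\sigma(2)}}\curlywedge_{\sigma,2}\cdots\curlywedge_{\sigma,k+l-1}P_{m_{\sigma(k+l)}},$$ where $\mathrm{Shuff}(k,l)$ is the set of permutations $\sigma$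 of $\{1,\dots,k+l\}$ with $\sigma^{-1}(1)<\dots<\sigma^{-1}(k)$ and $\sigma^{-1}(k+1)<\dots<\sigma^{-1}(k+l)$, and $\curlywedge_{\sigma,i}$ is $\succ$ if $\sigma(i)\le k<\sigma(i+1)$ and $\prec$ otherwise. *Pseudo-differential operators.* Let $\mathcal R_0$ be an associative unital $\mathbb K$-algebra with product $\ast$ and a derivation $\partial_x$, and let $u_2,u_3,\dots\in\mathcal R_0$. Formal pseudo-differential operators $\sum_{i\le N}a_i\partial^i$ ($a_i\in\mathcal R_0$) are multiplied by means of $\partial^i a=\sum_{j\ge 0}\binom ij(\partial_x^j a)\,\partial^{i-j}$, $i\in\mathbb Z$. Let $X_{\ge 0}$, $X_{<0}$ be the parts of $X$ with nonnegative, respectively negative, powers of $\partial$, let $\mathrm{res}\,X$ be the coefficient of $\partial^{-1}$, and let $L=\partial+\sum_{n\ge1}u_{n+1}\partial^{-n}$. Let $\ell$ be the linear map from $\mathcal A(P)$ to pseudo-differential operators with $$\ell(P)=L,\qquad \ell(\alpha\prec P)=-\ell(\alpha)_{<0}\ast L,\qquad \ell(\alpha\succ P)=\ell(\alpha)_{\ge0}\ast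 L,$$ and put $L^{m_1,\dots,m_k}:=\ell(P_{m_1\dots m_k})$ and $\Phi(\alpha):=\mathrm{res}\,\ell(\alpha)\in\mathcal R_0$. Let $\mathcal R$ be the algebra of pseudo-differential operators generated by $L$ and $\partial^{-1}$ with the help of $\ast$ and the projection $(\;)_{\ge0}$; it contains all $\Phi(\alpha)$ (as operators of order zero). (i) Let $L$ be generic, i.e. let $\mathcal R_0$ be the free associative $\mathbb K$-algebra on the symbols $\partial_x^j u_n$ ($n\ge2$, $j\ge0$). Then there is exactly one family of linear operators $\delta_{m_1\dots m_k}:\mathcal R\to\mathcal R$ ($k\ge0$, $m_i\ge1$, with $\delta=\mathrm{id}$ for $k=0$) such that $$\delta_{m_1\dots m_k}L=-[L^{m_1,\dots,m_k}_{<0},L]+\sum_{j=1}^{k-1}(\delta_{m_1\dots m_j}L)\ast L^{m_{j+1},\dots,m_k}_{<0}\qquad(k\ge1),$$ $$\delta_{m_1\dots m_k}(X_{\ge0})=(\delta_{m_1\dots m_k}X)_{\ge0},\qquad \delta_{m_1\dots m_k}(X\ast Y)=\sum_{j=0}^k(\delta_{m_1\dots m_j}X)\ast(\delta_{m_{j+1}\dots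 m_k}Y)$$ for all $X,Y\in\mathcal R$, and for all $k\ge1$, $m_1,\dots,m_k\ge1$ and $\alpha\in\mathcal A(P)$, $$\delta_{m_1\dots m_k}\Phi(\alpha)=\Phi(P_{m_1\dots m_k}\circ\alpha).$$ (ii) (Identification $\delta=\partial_t$.) Let $(\mathcal R_0,\ast,\partial_x)$ and $u_2,u_3,\dots$ be arbitrary, and let $\partial_{t_{m_1\dots m_k}}$ ($k\ge1$; the identity for $k=0$) be linear operators on $\mathcal R_0$ which commute with $\partial_x$, satisfy $$\partial_{t_{m_1\dots m_k}}(f\ast g)=\sum_{j=0}^k(\partial_{t_{m_1\dots m_j}}f)\ast(\partial_{t_{m_{j+1}\dots m_k}}g),$$ and, acting on the coefficients of $L$, satisfy for all $k\ge1$ $$\partial_{t_{m_1\dots m_k}}L=-[L^{m_1,\dots,m_k}_{<0},L]+\sum_{j=1}^{k-1}(\partial_{t_{m_1\dots m_j}}L)\ast L^{m_{j+1},\dots,m_k}_{<0}.$$ Then $\partial_{t_{m_1\dots m_k}}\Phi(\alpha)=\Phi(P_{m_1\dots m_k}\circ\alpha)$ for all $k\ge1$, $m_1,\dots,m_k\ge1$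 and $\alpha\in\mathcal A(P)$. If moreover $\phi\in\mathcal R_0$ is a potential, $\partial_x\phi=u_2$, then for all nonempty words $v=m_1\dots m_k$ and $w=n_1\dots n_l$ $$\partial_x\,\partial_{t_w}\phi=\partial_x\,\Phi(P_w),\qquad \partial_x\,\partial_{t_v}\partial_{t_w}\phi=\partial_x\,\Phi(P_v\circ P_w),$$ and if $\partial_{t_w}\phi=\Phi(P_w)$ for all nonempty words $w$, then $\partial_{t_v}\partial_{t_w}\phi=\Phi(P_v\circ P_w)$ for all nonempty words $v,w$. -/

import Mathlib

namespace NCKP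

/-! ## The algebra `A(P)` -/

/-- Nonempty words `m₁ … m_k` in the positive integers; they index the basis `P_{m₁ … m_k}`. -/
abbrev Word : Type := {w : List ℕ+ // w ≠ []}

/-- The non-unital algebra `A(P)` generated by a single element `P`, with basis
`P_{m₁ … m_k} = P_{m₁} ≺ … ≺ P_{m_k}`, where `k ≥ 1`, `m_i ≥ 1` and `P_n = P • … • P`. -/
abbrev AP (K : Type*) [Field K] : Type _ := Word →₀ K

section AP

variable (K : Type*) [Field K]

/-- Bilinear extension to `A(P)` of a product given on the basis. -/
noncomputable def bilin (f : Word → Word → AP K) : AP K →ₗ[K] AP K →ₗ[K] AP K :=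
  Finsupp.linearCombination K fun v => Finsupp.linearCombination K (f v)

/-- `P_{m₁ … m_k}` for a nonempty word (the empty word is not used; it gets the value `0`). -/
noncomputable def P (w : List ℕ+) : AP K :=
  if h : w ≠ [] then Finsupp.single ⟨w, h⟩ 1 else 0

/-- The product `≺`: concatenation of words. -/
noncomputable def prec : AP K →ₗ[K] AP K →ₗ[K] AP K :=
  bilin K fun v w => P K (v.1 ++ w.1)

/-- The product `•`: the last letter of the first word and the first letter of the second word
are added, `(v ≺ P_m) • (P_n ≺ w) = v ≺ P_{m+n} ≺ w`. -/
noncomputable def bullet : AP K →ₗ[K] AP K →ₗ[K] AP K :=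
  bilin K fun v w =>
    P K (v.1.dropLast ++ (v.1.getLast v.2 + w.1.head w.2) :: w.1.tail)

/-- The combined product `α ≻ β = α ≺ β + α • β`. -/
noncomputable def succ : AP K →ₗ[K] AP K →ₗ[K] AP K := prec K + bullet K

theorem P_cons (m : ℕ+) (w : List ℕ+) (hw : w ≠ []) :
    P K (m :: w) = prec K (P K [m]) (P K w) := by
  simp [prec, bilin, P, hw]

theorem P_add_one (n : ℕ+) : P K [n + 1] = bullet K (P K [n]) (P K [1]) := by
  simp [bullet, bilin, P]

/-- The `(m,n)`-shuffles: arrangements `σ(1), …, σ(m+n)` of the disjoint union of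
`{1, …, m}` and `{1, …, n}` in which the elements of each of the two sets appear in their
original order. (The second set plays the role of `{m+1, …, m+n}`.) -/
noncomputable def Shuff (m n : ℕ) : Finset (Fin (m + n) ≃ Fin m ⊕ Fin n) :=
  open Classical in
  Finset.univ.filter fun σ =>
    StrictMono (fun i : Fin m => σ.symm (Sum.inl i)) ∧
      StrictMono (fun j : Fin n => σ.symm (Sum.inr j))

/-- The product symbol between neighbours `σ(i)`, `σ(i+1)` of a shuffle of two words written
with `≺` only: `≻` when passing from the first word to the second, `≺` when passing from the
second to the first, and the original symbol `≺` inside one of the words. -/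
noncomputable def link {m n : ℕ} : Fin m ⊕ Fin n → Fin m ⊕ Fin n → AP K →ₗ[K] AP K →ₗ[K] AP K
  | Sum.inl _, Sum.inr _ => succ K
  | Sum.inr _, Sum.inl _ => prec K
  | Sum.inl _, Sum.inl _ => prec K
  | Sum.inr _, Sum.inr _ => prec K

/-- `A_{s₁} ⋏ A_{s₂} ⋏ … ⋏ A_{s_N}` with product symbols `op s_i s_{i+1}`. All brackets give the
same value, as `≺` and `≻` are associative and mutually associative. -/
noncomputable def chain {S : Type*} (A : S → AP K) (op : S → S → AP K →ₗ[K] AP K →ₗ[K] AP K) :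
    List S → AP K
  | [] => 0
  | [s] => A s
  | s :: t :: l => op s t (A s) (chain A op (t :: l))

/-- The main product `∘` (mixable shuffle product), given on the basis by the sum over all
shuffles and extended bilinearly. -/
noncomputable def circ : AP K →ₗ[K] AP K →ₗ[K] AP K :=
  bilin K fun v w => ∑ σ ∈ Shuff v.1.length w.1.length,
    chain K (Sum.elim (fun i => P K [v.1.get i]) (fun j => P K [w.1.get j])) (link K)
      (List.ofFn σ)

end AP

/-! ## Formal pseudo-differential operators -/

section PsiDO

variable (K : Type*) [Field K] (A : Type*) [Ring A] [Algebra K A]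

/-- Formal pseudo-differential operators `∑_{i ≤ N} a_i ∂^i` with coefficients in `A`:
`X i` is the coefficient of `∂^i`. -/
def PsiDO : Submodule K (ℤ → A) where
  carrier := {X | ∃ N : ℤ, ∀ i, N < i → X i = 0}
  zero_mem' := ⟨0, fun _ _ => rfl⟩
  add_mem' := by
    rintro X Y ⟨N, hN⟩ ⟨M, hM⟩
    refine ⟨max N M, fun i hi => ?_⟩
    simp [hN i (lt_of_le_of_lt (le_max_left _ _) hi), hM i (lt_of_le_of_lt (le_max_right _ _) hi)]
  smul_mem' := by
    rintro c X ⟨N, hN⟩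
    exact ⟨N, fun i hi => by simp [hN i hi]⟩

variable {K A}

/-- The coefficient of `∂^n` in the product of `∑ a_i ∂^i` and `∑ b_j ∂^j`, according to
`∂^i b = ∑_{k ≥ 0} (i choose k) (d^k b) ∂^{i-k}`, where `d` is the derivation of `A`.
Only finitely many terms of the sum are nonzero. -/
noncomputable def mulCoeff (d : A →ₗ[K] A) (X Y : ℤ → A) (n : ℤ) : A :=
  ∑ᶠ p : ℤ × ℕ, Ring.choose p.1 p.2 • (X p.1 * (d ^ p.2) (Y (n - p.1 + p.2)))

theorem mulCoeff_support (d : A →ₗ[K] A) (X Y : PsiDO K A) (n : ℤ) :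
    (Function.support fun p : ℤ × ℕ =>
      Ring.choose p.1 p.2 • (X.1 p.1 * (d ^ p.2) (Y.1 (n - p.1 + p.2)))).Finite := by
  obtain ⟨N, hN⟩ := X.2
  obtain ⟨M, hM⟩ := Y.2
  refine ((Set.finite_Icc (n - M) N).prod (Set.finite_Iic (M - n + N).toNat)).subset ?_
  rintro ⟨i, k⟩ h
  have h1 : i ≤ N := by
    by_contra hi
    exact h (by simp [hN i (by omega)])
  have h2 : n - i + k ≤ M := by
    by_contra hi
    exact h (by simp [hM (n - i + k) (by omega)])
  simp only [Set.mem_prod, Set.mem_Icc, Set.mem_Iic]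
  omega

/-- The product of pseudo-differential operators. -/
noncomputable def mul (d : A →ₗ[K] A) : PsiDO K A →ₗ[K] PsiDO K A →ₗ[K] PsiDO K A :=
  LinearMap.mk₂ K
    (fun X Y => ⟨mulCoeff d X.1 Y.1, by
      obtain ⟨N, hN⟩ := X.2
      obtain ⟨M, hM⟩ := Y.2
      refine ⟨N + M, fun n hn => ?_⟩
      refine finsum_eq_zero_of_forall_eq_zero fun p => ?_
      by_cases h : N < p.1
      · simp [hN _ h]
      · simp [hM (n - p.1 + p.2) (by omega)]⟩)
    (fun X X' Y => by
      ext n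
      change mulCoeff d (X + X').1 Y.1 n = mulCoeff d X.1 Y.1 n + mulCoeff d X'.1 Y.1 n
      unfold mulCoeff
      rw [← finsum_add_distrib (mulCoeff_support d X Y n) (mulCoeff_support d X' Y n)]
      exact finsum_congr fun p => by simp [add_mul])
    (fun c X Y => by
      ext n
      change mulCoeff d (c • X).1 Y.1 n = c • mulCoeff d X.1 Y.1 n
      unfold mulCoeff
      rw [smul_finsum' c (mulCoeff_support d X Y n)]
      exact finsum_congr fun p => by simp)
    (fun X Y Y' => by
      ext n
      change mulCoeff d X.1 (Y + Y').1 n = mulCoeff d X.1 Y.1 n + mulCoeff d X.1 Y'.1 n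
      unfold mulCoeff
      rw [← finsum_add_distrib (mulCoeff_support d X Y n) (mulCoeff_support d X Y' n)]
      exact finsum_congr fun p => by simp [mul_add])
    (fun c X Y => by
      ext n
      change mulCoeff d X.1 (c • Y).1 n = c • mulCoeff d X.1 Y.1 n
      unfold mulCoeff
      rw [smul_finsum' c (mulCoeff_support d X Y n)]
      exact finsum_congr fun p => by simp)

/-- The projection `X ↦ X_{≥ 0}`. -/
def pos : PsiDO K A →ₗ[K] PsiDO K A where
  toFun X := ⟨fun i => if 0 ≤ i then X.1 i else 0, by
    obtain ⟨N, hN⟩ := X.2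
    exact ⟨N, fun i hi => by simp [hN i hi]⟩⟩
  map_add' X Y := by ext i; by_cases h : 0 ≤ i <;> simp [h]
  map_smul' c X := by ext i; by_cases h : 0 ≤ i <;> simp [h]

/-- The projection `X ↦ X_{< 0}`. -/
def neg : PsiDO K A →ₗ[K] PsiDO K A where
  toFun X := ⟨fun i => if i < 0 then X.1 i else 0, by
    obtain ⟨N, hN⟩ := X.2
    exact ⟨N, fun i hi => by simp [hN i hi]⟩⟩
  map_add' X Y := by ext i; by_cases h : i < 0 <;> simp [h]
  map_smul' c X := by ext i; by_cases h : i < 0 <;> simp [h]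

/-- The residue: the coefficient of `∂^{-1}`. -/
def res : PsiDO K A →ₗ[K] A where
  toFun X := X.1 (-1)
  map_add' _ _ := rfl
  map_smul' _ _ := rfl

/-- The operator `a ∂^n`. -/
def monomial (n : ℤ) : A →ₗ[K] PsiDO K A where
  toFun a := ⟨fun i => if i = n then a else 0, ⟨n, fun i hi => by simp [hi.ne']⟩⟩
  map_add' a b := by ext i; by_cases h : i = n <;> simp [h]
  map_smul' c a := by ext i; by_cases h : i = n <;> simp [h]

/-- A linear map of the coefficients acting coefficientwise. -/
def mapCoeff (f : A →ₗ[K] A) : PsiDO K A →ₗ[K] PsiDO K A where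
  toFun X := ⟨fun i => f (X.1 i), by
    obtain ⟨N, hN⟩ := X.2
    exact ⟨N, fun i hi => by simp [hN i hi]⟩⟩
  map_add' X Y := by ext i; simp
  map_smul' c X := by ext i; simp

variable (K)

/-- `L = ∂ + ∑_{n ≥ 1} u_{n+1} ∂^{-n}`. The sequence is indexed from `0`: `u k` is `u_{k+2}`, the
coefficient of `∂^{-(k+1)}`. -/
def Lax (u : ℕ → A) : PsiDO K A :=
  ⟨fun i => if i = 1 then 1 else if i < 0 then u (-1 - i).toNat else 0,
    ⟨1, fun i hi => by
      have h1 : i ≠ 1 := by omega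
      have h2 : ¬ i < 0 := by omega
      simp [h1, h2]⟩⟩

variable {K}

/-- `ℓ` on a basis word, read from right to left:
`ℓ(α • P) = ℓ(α) * L`, `ℓ(α ≺ P) = - ℓ(α)_{<0} * L`, `ℓ(P) = L`. -/
noncomputable def ellWord (d : A →ₗ[K] A) (u : ℕ → A) : List ℕ+ → PsiDO K A
  | [] => 0
  | [m] => (fun X => mul d X (Lax K u))^[(m : ℕ) - 1] (Lax K u)
  | m :: n :: w => (fun X => mul d X (Lax K u))^[(m : ℕ) - 1]
      (-mul d (neg (ellWord d u (n :: w))) (Lax K u))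

/-- The linear map `ℓ` from `A(P)` to pseudo-differential operators; see `ell_P`, `ell_prec` and
`ell_succ` for its defining properties. -/
noncomputable def ell (d : A →ₗ[K] A) (u : ℕ → A) : AP K →ₗ[K] PsiDO K A :=
  Finsupp.linearCombination K fun w => ellWord d u w.1.reverse

/-- `Φ(α) = res ℓ(α)`. -/
noncomputable def Phi (d : A →ₗ[K] A) (u : ℕ → A) : AP K →ₗ[K] A := res ∘ₗ ell d u

theorem ell_P (d : A →ₗ[K] A) (u : ℕ → A) : ell d u (P K [1]) = Lax K u := by
  simp [ell, P, ellWord]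

theorem ell_single (d : A →ₗ[K] A) (u : ℕ → A) (w : List ℕ+) :
    ell d u (P K w) = ellWord d u w.reverse := by
  by_cases h : w = []
  · subst h; simp [ell, P, ellWord]
  · simp [ell, P, h]

theorem ell_prec (d : A →ₗ[K] A) (u : ℕ → A) (α : AP K) :
    ell d u (prec K α (P K [1])) = -mul d (neg (ell d u α)) (Lax K u) := by
  induction α using Finsupp.induction_linear with
  | zero => simp
  | add α β hα hβ => simp only [map_add, LinearMap.add_apply, hα, hβ, neg_add]
  | single w c =>
    have hs : (Finsupp.single w c : AP K) = c • P K w.1 := by simp [P, w.2]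
    have hp : prec K (P K w.1) (P K [1]) = P K (w.1 ++ [1]) := by
      simp [prec, bilin, P, w.2]
    rw [hs]
    simp only [map_smul, LinearMap.smul_apply, hp, ell_single, List.reverse_append]
    obtain ⟨n, l, hl⟩ : ∃ n l, w.1.reverse = n :: l :=
      List.exists_cons_of_ne_nil (by simpa using w.2)
    simp [hl, ellWord]

theorem ell_bullet (d : A →ₗ[K] A) (u : ℕ → A) (α : AP K) :
    ell d u (bullet K α (P K [1])) = mul d (ell d u α) (Lax K u) := by
  induction α using Finsupp.induction_linear with
  | zero => simp
  | add α β hα hβ => simp only [map_add, LinearMap.add_apply, hα, hβ]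
  | single w c =>
    have hs : (Finsupp.single w c : AP K) = c • P K w.1 := by simp [P, w.2]
    have hp : bullet K (P K w.1) (P K [1]) = P K (w.1.dropLast ++ [w.1.getLast w.2 + 1]) := by
      simp [bullet, bilin, P, w.2]
    rw [hs]
    simp only [map_smul, LinearMap.smul_apply, hp, ell_single, List.reverse_append]
    have hw : w.1.reverse = w.1.getLast w.2 :: w.1.dropLast.reverse := by
      conv_lhs => rw [← List.dropLast_append_getLast w.2]
      simp
    rw [hw]
    obtain ⟨k, hk⟩ : ∃ k, ((w.1.getLast w.2 : ℕ+) : ℕ) = k + 1 :=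
      Nat.exists_eq_succ_of_ne_zero (PNat.ne_zero _)
    rcases w.1.dropLast.reverse with _ | ⟨n, l⟩ <;>
      simp [ellWord, hk, Function.iterate_succ_apply', -Function.iterate_succ]

theorem pos_add_neg (X : PsiDO K A) : pos X + neg X = X := by
  ext i
  by_cases h : 0 ≤ i
  · simp [pos, neg, h, not_lt.mpr h]
  · simp [pos, neg, h, not_le.mp h]

theorem ell_succ (d : A →ₗ[K] A) (u : ℕ → A) (α : AP K) :
    ell d u (succ K α (P K [1])) = mul d (pos (ell d u α)) (Lax K u) := by
  have h : mul d (ell d u α) (Lax K u) =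
      mul d (pos (ell d u α)) (Lax K u) + mul d (neg (ell d u α)) (Lax K u) := by
    rw [← LinearMap.add_apply, ← map_add, pos_add_neg]
  rw [succ, LinearMap.add_apply, LinearMap.add_apply, map_add, ell_prec, ell_bullet, h]
  abel

/-! ## The algebra generated by `L` and its generalized derivations -/

/-- The algebra `ℛ` of pseudo-differential operators generated by `L` and the inverse `∂^{-1}` of
`∂ = L_{≥ 0}` with the help of the product and the projection `( )_{≥ 0}`. -/
noncomputable def OpAlg (d : A →ₗ[K] A) (u : ℕ → A) : Submodule K (PsiDO K A) :=
  sInf {S | Lax K u ∈ S ∧ monomial (-1) 1 ∈ S ∧ (∀ X ∈ S, ∀ Y ∈ S, mul d X Y ∈ S) ∧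
    ∀ X ∈ S, pos X ∈ S}

section OpAlg

variable (d : A →ₗ[K] A) (u : ℕ → A)

theorem lax_mem : Lax K u ∈ OpAlg d u :=
  (Submodule.mem_sInf).2 fun _ hS => hS.1

theorem mul_mem {X Y : PsiDO K A} (hX : X ∈ OpAlg d u) (hY : Y ∈ OpAlg d u) :
    mul d X Y ∈ OpAlg d u :=
  (Submodule.mem_sInf).2 fun S hS =>
    hS.2.2.1 X ((Submodule.mem_sInf).1 hX S hS) Y ((Submodule.mem_sInf).1 hY S hS)

theorem pos_mem {X : PsiDO K A} (hX : X ∈ OpAlg d u) : pos X ∈ OpAlg d u :=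
  (Submodule.mem_sInf).2 fun S hS => hS.2.2.2 X ((Submodule.mem_sInf).1 hX S hS)

theorem neg_mem {X : PsiDO K A} (hX : X ∈ OpAlg d u) : neg X ∈ OpAlg d u := by
  rw [show neg X = X - pos X by rw [eq_sub_iff_add_eq', pos_add_neg]]
  exact Submodule.sub_mem _ hX (pos_mem d u hX)

theorem ellWord_mem (w : List ℕ+) : ellWord d u w ∈ OpAlg d u := by
  have key : ∀ (k : ℕ) (X : PsiDO K A), X ∈ OpAlg d u →
      (fun X => mul d X (Lax K u))^[k] X ∈ OpAlg d u := by
    intro k X hX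
    induction k with
    | zero => exact hX
    | succ k ih =>
      rw [Function.iterate_succ_apply']
      exact mul_mem d u ih (lax_mem d u)
  induction w with
  | nil => exact Submodule.zero_mem _
  | cons m w ih =>
    rcases w with _ | ⟨n, w⟩
    · exact key _ _ (lax_mem d u)
    · exact key _ _ (Submodule.neg_mem _ (mul_mem d u (neg_mem d u ih) (lax_mem d u)))

theorem ell_mem (α : AP K) : ell d u α ∈ OpAlg d u := by
  rw [ell, Finsupp.linearCombination_apply]
  exact Submodule.sum_mem _ fun w _ => Submodule.smul_mem _ _ (ellWord_mem d u _)

theorem pos_lax : pos (Lax K u) = monomial 1 1 := by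
  ext i
  by_cases h1 : i = 1
  · simp [pos, Lax, monomial, h1]
  · by_cases h : 0 ≤ i
    · simp [pos, Lax, monomial, h1, not_lt.mpr h]
    · simp [pos, monomial, h1, h]

/-- `res X = (X_{< 0} ∂)_{≥ 0}` as operators of order zero. -/
theorem monomial_res (X : PsiDO K A) :
    monomial 0 (res X) = pos (mul d (neg X) (pos (Lax K u))) := by
  rw [pos_lax]
  ext i
  change (if i = 0 then X.1 (-1) else 0) =
    if 0 ≤ i then mulCoeff d (neg X).1 (monomial (K := K) 1 (1 : A)).1 i else 0
  by_cases hi : 0 ≤ i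
  · rw [if_pos hi, mulCoeff, finsum_eq_single _ ((-1 : ℤ), (0 : ℕ))]
    · by_cases h0 : i = 0 <;> simp [neg, monomial, h0]
    · rintro ⟨p, k⟩ hp
      have h : ¬ (p < 0 ∧ i - p + k = 1) := by
        rintro ⟨h1, h2⟩
        exact hp (Prod.ext (by simp only; omega) (by simp only; omega))
      by_cases h1 : p < 0
      · have h2 : i - p + k ≠ 1 := fun h2 => h ⟨h1, h2⟩
        simp [monomial, h2]
      · simp [neg, h1]
  · have h0 : i ≠ 0 := by omega
    rw [if_neg hi, if_neg h0]

theorem Phi_mem (α : AP K) : monomial 0 (Phi d u α) ∈ OpAlg d u := by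
  rw [Phi, LinearMap.comp_apply, monomial_res d u]
  exact pos_mem d u (mul_mem d u (neg_mem d u (ell_mem d u α)) (pos_mem d u (lax_mem d u)))

/-- `L` as an element of `ℛ`. -/
noncomputable def opLax : OpAlg d u := ⟨Lax K u, lax_mem d u⟩

/-- The product of `ℛ`. -/
noncomputable def opMul (X Y : OpAlg d u) : OpAlg d u := ⟨mul d X.1 Y.1, mul_mem d u X.2 Y.2⟩

/-- The projection `( )_{≥ 0}` of `ℛ`. -/
noncomputable def opPos (X : OpAlg d u) : OpAlg d u := ⟨pos X.1, pos_mem d u X.2⟩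

/-- `Φ(α)` as an element of `ℛ` (an operator of order zero). -/
noncomputable def opPhi (α : AP K) : OpAlg d u := ⟨monomial 0 (Phi d u α), Phi_mem d u α⟩

/-- The right-hand side of the generalized Lax equation for `w = m₁ … m_k`,
`-[L^{m₁,…,m_k}_{<0}, L] + ∑_{j=1}^{k-1} D_{m₁…m_j} * L^{m_{j+1},…,m_k}_{<0}`,
where `L^{m₁,…,m_k} = ℓ(P_{m₁…m_k})` and `D_v` stands for the `v`-th flow of `L`. -/
noncomputable def laxRHS (D : List ℕ+ → PsiDO K A) (w : List ℕ+) : PsiDO K A :=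
  -(mul d (neg (ell d u (P K w))) (Lax K u) - mul d (Lax K u) (neg (ell d u (P K w)))) +
    ∑ j ∈ Finset.Ico 1 w.length, mul d (D (w.take j)) (neg (ell d u (P K (w.drop j))))

/-- The defining relations of the generalized derivations `δ_{m₁ … m_k}` of `ℛ`, where `δ` of the
empty word is the identity: `δ_{m₁…m_k} L` is given by the generalized Lax equation,
`δ_w (X_{≥ 0}) = (δ_w X)_{≥ 0}`, and
`δ_{m₁…m_k} (X * Y) = ∑_{j=0}^k (δ_{m₁…m_j} X) * (δ_{m_{j+1}…m_k} Y)`. -/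
structure IsDelta (δ : List ℕ+ → Module.End K (OpAlg d u)) : Prop where
  nil : δ [] = 1
  lax : ∀ w, w ≠ [] → (δ w (opLax d u)).1 = laxRHS d u (fun v => (δ v (opLax d u)).1) w
  pos : ∀ w X, δ w (opPos d u X) = opPos d u (δ w X)
  mul : ∀ w X Y, δ w (opMul d u X Y) =
    ∑ j ∈ Finset.range (w.length + 1), opMul d u (δ (w.take j) X) (δ (w.drop j) Y)

/-- `u` solves the extended hierarchy: `d = ∂_x` is a derivation of the coefficient algebra, the
operators `T w = ∂_{t_w}` commute with `∂_x`, obey the differentiation rule of the deformed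
product, and the flows of `L` are `∂_{t_w} L = δ_w L`. -/
structure IsHierarchySolution (T : List ℕ+ → A →ₗ[K] A) : Prop where
  leibniz : ∀ a b, d (a * b) = d a * b + a * d b
  nil : T [] = LinearMap.id
  comm : ∀ w a, T w (d a) = d (T w a)
  mul : ∀ w a b, T w (a * b) =
    ∑ j ∈ Finset.range (w.length + 1), T (w.take j) a * T (w.drop j) b
  lax : ∀ w, w ≠ [] → mapCoeff (T w) (Lax K u) = laxRHS d u (fun v => mapCoeff (T v) (Lax K u)) w

end OpAlg

end PsiDO

/-! ## The generic operator `L` -/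

section Generic

variable (K : Type*) [Field K]

/-- The algebra of noncommutative differential polynomials in `u₂, u₃, …`: the free associative
algebra on symbols `(k, j)`, which stand for the `j`-th `x`-derivative of `u_{k+2}`. -/
abbrev DiffPoly : Type _ := FreeAlgebra K (ℕ × ℕ)

/-- `f ↦ f + ε ∂_x f`. -/
noncomputable def dxHom : DiffPoly K →ₐ[K] DualNumber (DiffPoly K) :=
  FreeAlgebra.lift K fun p =>
    TrivSqZeroExt.inl (FreeAlgebra.ι K p) + TrivSqZeroExt.inr (FreeAlgebra.ι K (p.1, p.2 + 1))

/-- The derivation `∂_x` of the algebra of differential polynomials. -/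
noncomputable def dx : DiffPoly K →ₗ[K] DiffPoly K where
  toFun f := (dxHom K f).snd
  map_add' _ _ := by simp
  map_smul' _ _ := by simp

theorem dx_gen (k j : ℕ) : dx K (FreeAlgebra.ι K (k, j)) = FreeAlgebra.ι K (k, j + 1) := by
  simp [dx, dxHom]

theorem dx_mul (a b : DiffPoly K) : dx K (a * b) = dx K a * b + a * dx K b := by
  have h : ((TrivSqZeroExt.fstHom K (DiffPoly K) (DiffPoly K)).comp (dxHom K)) =
      AlgHom.id K (DiffPoly K) := by
    ext p
    simp [dxHom]
  have h' : ∀ f, (dxHom K f).fst = f := fun f => DFunLike.congr_fun h f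
  change (dxHom K (a * b)).snd = (dxHom K a).snd * b + a * (dxHom K b).snd
  rw [map_mul, TrivSqZeroExt.snd_mul, h', h']
  simp [add_comm]

/-- The generic coefficients: `genericU k` is `u_{k+2}`. -/
noncomputable def genericU (k : ℕ) : DiffPoly K := FreeAlgebra.ι K (k, 0)

end Generic

end NCKP

/-! The flows are collected into generating series in noncommuting variables t_m, multiplied by
deconcatenation of words. The deformed Leibniz rule then says that H(X) = ∑_w (∂_{t_w} X) t_w is
multiplicative. Put e = ∑_w ℓ(P_w) t_w, W = 1 - e_{<0} and V = 1 + e_{≥0}. The recursion for ℓ reads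
e = W ∑_m L^m t_m, so V = W (1 + ∑_m L^m t_m) (`dressing_mul_one_add_powers`). The Lax equations
read H(L) W = W L (`mul_dressing_of_lax`). Since L commutes with ∑_m L^m t_m, also H(L) V = V L.

Under ℓ, the product P_v ∘ P_w becomes a sum over shuffles evaluated by peeling letters off on the
right (`ell_circ`). With X = H(ℓ(P_w)), the shuffles ending in a letter of w contribute the
v-coefficient of X V, and those ending in a letter of v that of -X_{<0} (V - W). Hence ℓ(P_v ∘ P_w)
is the v-coefficient of X_{≥0} V + X_{<0} W (`shuffleSum_eq`). The first term has no negative powers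
of ∂, and X_{<0} W differs from X_{<0} only in order at most -2, so the residue is ∂_{t_v} Φ(P_w)
(`flow_Phi_P`).

For generic L, the Lax equations are solved by recursion on the length of the word (`laxFlow`). The
solutions have negative order, so they prescribe flows of the u_n, and freeness extends these to a
homomorphism H. Conversely H is determined on ℛ by its value on L, because ∂ = L_{≥0} and inverses
are unique (`isDelta_unique`). The claims on the potential come from the residue of the Lax
equation, ∂_{t_w} u_2 = ∂_x Φ(P_w) (`laxRHS_apply`). -/

namespace NCKP

/-! ## Formal series in noncommuting variables indexed by words -/

/-- Formal series in noncommuting variables `t_m`, `m ≥ 1`, with coefficients in `B` which commute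
with the variables: `f w` is the coefficient of the word `w`. -/
def Series (B : Type*) : Type _ := List ℕ+ → B

namespace Series

variable {B : Type*}

@[ext] theorem ext {f g : Series B} (h : ∀ w, f w = g w) : f = g := funext h

instance [AddCommGroup B] : AddCommGroup (Series B) :=
  inferInstanceAs (AddCommGroup (List ℕ+ → B))

instance {R : Type*} [Semiring R] [AddCommGroup B] [Module R B] : Module R (Series B) :=
  inferInstanceAs (Module R (List ℕ+ → B))

@[simp] theorem add_apply [AddCommGroup B] (f g : Series B) (w : List ℕ+) :
    (f + g) w = f w + g w := rfl

@[simp] theorem sub_apply [AddCommGroup B] (f g : Series B) (w : List ℕ+) :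
    (f - g) w = f w - g w := rfl

@[simp] theorem neg_apply [AddCommGroup B] (f : Series B) (w : List ℕ+) : (-f) w = -f w := rfl

@[simp] theorem zero_apply [AddCommGroup B] (w : List ℕ+) : (0 : Series B) w = 0 := rfl

@[simp] theorem smul_apply {R : Type*} [Semiring R] [AddCommGroup B] [Module R B] (r : R)
    (f : Series B) (w : List ℕ+) : (r • f) w = r • f w := rfl

/-- A constant series. -/
def const [Zero B] (b : B) : Series B
  | [] => b
  | _ :: _ => 0

@[simp] theorem const_nil [Zero B] (b : B) : const b [] = b := rfl

@[simp] theorem const_cons [Zero B] (b : B) (m : ℕ+) (w : List ℕ+) : const b (m :: w) = 0 := rfl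

/-- The series whose coefficients are those of the words starting with `m`. -/
def shift (m : ℕ+) (f : Series B) : Series B := fun w => f (m :: w)

@[simp] theorem shift_apply (m : ℕ+) (f : Series B) (w : List ℕ+) : shift m f w = f (m :: w) := rfl

/-- A map of the coefficients acting coefficientwise. -/
def mapAdd [AddCommGroup B] (φ : B →+ B) : Series B →+ Series B where
  toFun f w := φ (f w)
  map_zero' := by ext w; simp
  map_add' f g := funext fun w => φ.map_add (f w) (g w)

@[simp] theorem mapAdd_apply [AddCommGroup B] (φ : B →+ B) (f : Series B) (w : List ℕ+) :
    mapAdd φ f w = φ (f w) := rfl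

section Ring

variable [Ring B]

instance : Mul (Series B) :=
  ⟨fun f g w => ∑ j ∈ Finset.range (w.length + 1), f (w.take j) * g (w.drop j)⟩

instance : One (Series B) := ⟨const 1⟩

theorem mul_apply (f g : Series B) (w : List ℕ+) :
    (f * g) w = ∑ j ∈ Finset.range (w.length + 1), f (w.take j) * g (w.drop j) := rfl

theorem one_def : (1 : Series B) = const 1 := rfl

@[simp] theorem mul_nil (f g : Series B) : (f * g) [] = f [] * g [] := by simp [mul_apply]

theorem mul_cons (f g : Series B) (m : ℕ+) (w : List ℕ+) :
    (f * g) (m :: w) = f [] * g (m :: w) + (shift m f * g) w := by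
  simp only [mul_apply, List.length_cons, Finset.sum_range_succ' _ (w.length + 1), List.take_zero,
    List.drop_zero, List.take_succ_cons, List.drop_succ_cons, shift_apply]
  rw [add_comm]

@[simp] theorem const_mul_apply (b : B) (f : Series B) (w : List ℕ+) :
    (const b * f) w = b * f w := by
  cases w with
  | nil => simp
  | cons m w =>
    rw [mul_cons]
    simp [mul_apply]

@[simp] theorem mul_const_apply (b : B) (f : Series B) (w : List ℕ+) :
    (f * const b) w = f w * b := by
  induction w generalizing f with
  | nil => simp
  | cons m w ih => simp [mul_cons, ih]

theorem add_mul_aux (f g h : Series B) : (f + g) * h = f * h + g * h := by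
  ext w; simp [mul_apply, add_mul, Finset.sum_add_distrib]

theorem mul_add_aux (f g h : Series B) : f * (g + h) = f * g + f * h := by
  ext w; simp [mul_apply, mul_add, Finset.sum_add_distrib]

theorem const_mul_assoc (b : B) (f g : Series B) : const b * f * g = const b * (f * g) := by
  ext w
  simp [mul_apply (const b * f), mul_apply f, Finset.mul_sum, mul_assoc]

theorem shift_mul (m : ℕ+) (f g : Series B) :
    shift m (f * g) = const (f []) * shift m g + shift m f * g := by
  ext w
  simp [mul_cons]

/-- Induction on the word: removing the first letter obeys the twisted product rule `shift_mul`. -/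
theorem mul_assoc_aux (f g h : Series B) : f * g * h = f * (g * h) := by
  ext w
  induction w generalizing f with
  | nil => simp [mul_assoc]
  | cons m w ih =>
    rw [mul_cons, mul_cons, shift_mul, add_mul_aux, add_apply, ih, const_mul_assoc,
      const_mul_apply, mul_cons g h, mul_nil, mul_add, mul_assoc, add_assoc]

instance : Ring (Series B) :=
  { (inferInstance : AddCommGroup (Series B)) with
    mul := (· * ·)
    one := 1
    mul_assoc := mul_assoc_aux
    left_distrib := mul_add_aux
    right_distrib := add_mul_aux
    one_mul := fun f => by ext w; simp [one_def]
    mul_one := fun f => by ext w; simp [one_def]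
    zero_mul := fun f => by ext w; simp [mul_apply]
    mul_zero := fun f => by ext w; simp [mul_apply] }

@[simp] theorem one_nil : (1 : Series B) [] = 1 := rfl

@[simp] theorem one_cons (m : ℕ+) (w : List ℕ+) : (1 : Series B) (m :: w) = 0 := rfl

instance {K : Type*} [CommSemiring K] [Algebra K B] : Algebra K (Series B) :=
  Algebra.ofModule (fun r f g => by ext w; simp [mul_apply, Finset.smul_sum])
    (fun r f g => by ext w; simp [mul_apply, Finset.smul_sum])

/-- Multiplicative idempotents with constant term `1` are trivial. -/
theorem eq_one_of_mul_self {e : Series B} (h : e * e = e) (h0 : e [] = 1) : e = 1 := by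
  have key : ∀ (k : ℕ) (w : List ℕ+), w.length = k → e w = (1 : Series B) w := by
    intro k
    induction k using Nat.strong_induction_on with
    | _ k ih =>
      rintro (_ | ⟨m, w⟩) hw
      · exact h0
      · have h1 := congrFun h (m :: w)
        -- Proper prefixes vanish by induction, so only the two extreme cuts survive: x + x = x for
        -- x = e (m :: w).
        rw [mul_cons, h0, one_mul, mul_apply, Finset.sum_range_succ, Finset.sum_eq_zero] at h1
        · simpa [h0] using h1
        · intro j hj
          rw [Finset.mem_range] at hj
          have h2 : e (m :: w.take j) = 0 :=
            (ih (j + 1) (by simp at hw; omega) _ (by simp; omega)).trans (one_cons _ _)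
          simp [h2]
  exact ext fun w => key _ w rfl

theorem const_mul_const (a b : B) : const a * const b = const (a * b) := by
  ext w
  cases w <;> simp

/-- The series `∑_{m ≥ 1} L^m t_m`. -/
def powers (L : B) : Series B
  | [] => 0
  | [m] => L ^ (m : ℕ)
  | _ :: _ :: _ => 0

@[simp] theorem powers_nil (L : B) : powers L [] = 0 := rfl

/-- `powers L` lives on one-letter words, so only the cut before the last letter contributes. -/
theorem mul_powers_append (f : Series B) (L : B) (w : List ℕ+) (m : ℕ+) :
    (f * powers L) (w ++ [m]) = f w * L ^ (m : ℕ) := by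
  induction w generalizing f with
  | nil => simp [mul_cons, powers]
  | cons a w ih =>
    rw [List.cons_append, mul_cons, ih, shift_apply]
    cases w <;> simp [powers]

theorem powers_mul_const (L : B) : powers L * const L = const L * powers L := by
  ext w
  rw [mul_const_apply, const_mul_apply]
  rcases w with _ | ⟨m, _ | ⟨n, w⟩⟩
  · simp
  · exact (pow_succ L _).symm.trans (pow_succ' L _)
  · simp [powers]

end Ring

end Series

/-! ## Rings which split into two subrings -/

/-- A decomposition of a ring into the direct sum of a unital subring and a subring, given by the
two projections. -/
structure Splitting (B : Type*) [Ring B] where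
  /-- The projection to the unital subring. -/
  p : B →+ B
  /-- The projection to the other subring. -/
  n : B →+ B
  p_add_n : ∀ x, p x + n x = x
  p_n : ∀ x, p (n x) = 0
  p_one : p 1 = 1
  n_p_mul_p : ∀ x y, n (p x * p y) = 0
  p_n_mul_n : ∀ x y, p (n x * n y) = 0

namespace Splitting

variable {B : Type*} [Ring B] (s : Splitting B)

theorem n_eq (x : B) : s.n x = x - s.p x := eq_sub_of_add_eq' (s.p_add_n x)

theorem n_n (x : B) : s.n (s.n x) = s.n x := by rw [s.n_eq (s.n x), p_n, sub_zero]

theorem n_p (x : B) : s.n (s.p x) = 0 := by simpa [s.p_one] using s.n_p_mul_p x 1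

/-- The coefficientwise splitting of a ring of series. -/
def series : Splitting (Series B) where
  p := Series.mapAdd s.p
  n := Series.mapAdd s.n
  p_add_n f := by ext w; simp [s.p_add_n]
  p_n f := by ext w; simp [s.p_n]
  p_one := by ext w; cases w <;> simp [s.p_one]
  n_p_mul_p f g := by ext w; simp [Series.mul_apply, s.n_p_mul_p]
  p_n_mul_n f g := by ext w; simp [Series.mul_apply, s.p_n_mul_n]

@[simp] theorem series_p_apply (f : Series B) (w : List ℕ+) : s.series.p f w = s.p (f w) := rfl

@[simp] theorem series_n_apply (f : Series B) (w : List ℕ+) : s.series.n f w = s.n (f w) := rfl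

end Splitting

end NCKP

namespace NCKP

/-! ## Shuffles of lists -/

section Shuffles

variable {α β γ δ : Type*}

/-- All shuffles of two lists, with the origin of the entries recorded. -/
def shuffles : List α → List β → List (List (α ⊕ β))
  | [], [] => [[]]
  | x :: a, [] => (shuffles a []).map (Sum.inl x :: ·)
  | [], y :: b => (shuffles [] b).map (Sum.inr y :: ·)
  | x :: a, y :: b =>
    (shuffles a (y :: b)).map (Sum.inl x :: ·) ++ (shuffles (x :: a) b).map (Sum.inr y :: ·)
termination_by a b => a.length + b.length

theorem mem_shuffles {a : List α} {b : List β} {l : List (α ⊕ β)} :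
    l ∈ shuffles a b ↔ l.filterMap Sum.getLeft? = a ∧ l.filterMap Sum.getRight? = b := by
  induction l generalizing a b with
  | nil => cases a <;> cases b <;> simp [shuffles]
  | cons t l ih => 
    cases t <;> cases a <;> cases b <;> simp [shuffles, ih, List.filterMap_cons] <;> grind

/-- Lets the sum over this list be compared with the sum over the finite set `Shuff`. -/
theorem nodup_shuffles (a : List α) (b : List β) : (shuffles a b).Nodup := by
  induction a, b using shuffles.induct with
  | case1 => simp [shuffles]
  | case2 x a ih =>
    rw [shuffles]
    exact ih.map (List.cons_injective)
  | case3 y b ih =>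
    rw [shuffles]
    exact ih.map (List.cons_injective)
  | case4 x a y b ih1 ih2 =>
    rw [shuffles]
    refine (ih1.map List.cons_injective).append (ih2.map List.cons_injective) ?_
    intro l h1 h2
    simp only [List.mem_map] at h1 h2
    obtain ⟨l1, -, rfl⟩ := h1
    obtain ⟨l2, -, h⟩ := h2
    simp at h

theorem shuffles_map (f : α → γ) (g : β → δ) (a : List α) (b : List β) :
    shuffles (a.map f) (b.map g) = (shuffles a b).map (List.map (Sum.map f g)) := by
  induction a, b using shuffles.induct with
  | case1 => simp [shuffles]
  | case2 x a ih =>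
    simp only [List.map_cons, List.map_nil, shuffles, List.map_map] at ih ⊢
    rw [ih, List.map_map]
    rfl
  | case3 y b ih =>
    simp only [List.map_cons, List.map_nil, shuffles, List.map_map] at ih ⊢
    rw [ih, List.map_map]
    rfl
  | case4 x a y b ih1 ih2 =>
    simp only [List.map_cons, shuffles, List.map_map, List.map_append] at ih1 ih2 ⊢
    rw [ih1, ih2, List.map_map, List.map_map]
    rfl

theorem shuffles_nil_right (a : List α) : shuffles a ([] : List β) = [a.map Sum.inl] := by
  induction a with
  | nil => simp [shuffles]
  | cons x a ih => simp [shuffles, ih]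

theorem ne_nil_of_mem_shuffles_cons {a : List α} {y : β} {b : List β} {l : List (α ⊕ β)}
    (h : l ∈ shuffles a (y :: b)) : l ≠ [] := by
  rintro rfl
  simp [mem_shuffles] at h

end Shuffles

/-! ## Words in a ring with a splitting -/

section Evaluation

variable {B : Type*} [Ring B] (s : Splitting B) (L : B)

/-- The exponent of a letter of one of two words. -/
def letter (t : ℕ+ ⊕ ℕ+) : ℕ := Sum.elim (fun m : ℕ+ => (m : ℕ)) (fun m : ℕ+ => (m : ℕ)) t

/-- The projection which belongs to neighbours `t`, `x` of a shuffle: the projection to the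
unital subring when passing from the first word to the second one, minus the other projection
otherwise. -/
def linkProj : ℕ+ ⊕ ℕ+ → ℕ+ ⊕ ℕ+ → B →+ B
  | Sum.inl _, Sum.inr _ => s.p
  | _, _ => -s.n

/-- The value of a shuffle of two words, read from right to left. -/
def evalWord : List (ℕ+ ⊕ ℕ+) → B
  | [] => 0
  | [x] => L ^ letter x
  | x :: t :: l => linkProj s t x (evalWord (t :: l)) * L ^ letter x

/-- The sum over all shuffles of two words, read from right to left. -/
def shuffleSum (a b : List ℕ+) : B := ((shuffles a b).map (evalWord s L)).sum

/-- The sum over those shuffles of `a` and `y :: b` which start with `y`. -/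
def shuffleSumRight (y : ℕ+) (b a : List ℕ+) : B :=
  ((shuffles a b).map fun l => evalWord s L (Sum.inr y :: l)).sum

/-- The sum over those shuffles of `a` and `b` which start with the first letter of `a`. -/
def shuffleSumLeft (b : List ℕ+) : List ℕ+ → B
  | [] => 0
  | x :: a => ((shuffles a b).map fun l => evalWord s L (Sum.inl x :: l)).sum

theorem shuffleSum_cons (a : List ℕ+) (y : ℕ+) (b : List ℕ+) :
    shuffleSum s L a (y :: b) = shuffleSumRight s L y b a + shuffleSumLeft s L (y :: b) a := by
  cases a with
  | nil => simp [shuffleSum, shuffleSumRight, shuffleSumLeft, shuffles, Function.comp_def]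
  | cons x a =>
    simp [shuffleSum, shuffleSumRight, shuffleSumLeft, shuffles, Function.comp_def, add_comm]

theorem sum_map_addMonoidHom {ι : Type*} (φ : B →+ B) (f : ι → B) (l : List ι) :
    (l.map fun x => φ (f x)).sum = φ (l.map f).sum := by
  rw [map_list_sum, List.map_map]
  rfl

/-- The symbol before a letter of the first word is always ≺, whatever the preceding letter, so a
single projection factors out of the sum. -/
theorem shuffleSumLeft_cons (y : ℕ+) (b : List ℕ+) (x : ℕ+) (a : List ℕ+) :
    shuffleSumLeft s L (y :: b) (x :: a) = -s.n (shuffleSum s L a (y :: b)) * L ^ (x : ℕ) := by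
  have h : ∀ l ∈ shuffles a (y :: b), evalWord s L (Sum.inl x :: l) =
      ((AddMonoidHom.mulRight (L ^ (x : ℕ))).comp (-s.n)) (evalWord s L l) := by
    intro l hl
    rcases l with _ | ⟨t, l⟩
    · exact absurd rfl (ne_nil_of_mem_shuffles_cons hl)
    · cases t <;> rfl
  rw [shuffleSumLeft, List.map_congr_left h, sum_map_addMonoidHom]
  rfl

/-- The symbol before a letter of the second word depends on the origin of its predecessor: ≻ after
the first word (`s.p`), ≺ after the second (`-s.n`). -/
theorem shuffleSumRight_cons (y z : ℕ+) (b a : List ℕ+) :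
    shuffleSumRight s L y (z :: b) a =
      (s.p (shuffleSumLeft s L (z :: b) a) - s.n (shuffleSumRight s L z b a)) * L ^ (y : ℕ) := by
  have h1 : ∀ c : List ℕ+, ((shuffles c b).map fun l =>
      evalWord s L (Sum.inr y :: Sum.inr z :: l)).sum =
        -s.n (shuffleSumRight s L z b c) * L ^ (y : ℕ) := fun c =>
    sum_map_addMonoidHom ((AddMonoidHom.mulRight (L ^ (y : ℕ))).comp (-s.n)) _ _
  cases a with
  | nil =>
    have h2 := h1 []
    simp only [shuffleSumRight, shuffleSumLeft, shuffles, List.map_map, Function.comp_def,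
      map_zero, zero_sub] at h2 ⊢
    exact h2
  | cons x a =>
    have h2 : ((shuffles a (z :: b)).map fun l =>
        evalWord s L (Sum.inr y :: Sum.inl x :: l)).sum =
          s.p (shuffleSumLeft s L (z :: b) (x :: a)) * L ^ (y : ℕ) :=
      sum_map_addMonoidHom ((AddMonoidHom.mulRight (L ^ (y : ℕ))).comp s.p) _ _
    have h3 := h1 (x :: a)
    rw [shuffleSumRight, shuffles, List.map_append, List.sum_append, List.map_map, List.map_map,
      sub_eq_add_neg, add_mul]
    exact congrArg₂ (· + ·) h2 h3

/-- The recursion for the values `ℓ(P_w)`. -/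
structure IsEll (e : Series B) : Prop where
  nil : e [] = 0
  singleton : ∀ m : ℕ+, e [m] = L ^ (m : ℕ)
  append : ∀ (w : List ℕ+) (m : ℕ+), w ≠ [] → e (w ++ [m]) = -s.n (e w) * L ^ (m : ℕ)

variable {s L} {e : Series B} (he : IsEll s L e)

include he

theorem evalWord_map_inl (a : List ℕ+) : evalWord s L (a.map Sum.inl) = e a.reverse := by
  induction a with
  | nil => exact he.nil.symm
  | cons x a ih =>
    rcases a with _ | ⟨y, a⟩
    · exact (he.singleton x).symm
    · rw [List.reverse_cons, he.append _ _ (by simp), ← ih]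
      rfl

/-- There is only one shuffle. The summand `1` accounts for empty `w`, where `y` has no predecessor;
otherwise `y` is attached by ≻. -/
theorem shuffleSumRight_nil (y : ℕ+) (w : List ℕ+) :
    shuffleSumRight s L y [] w.reverse = (1 + s.series.p e) w * L ^ (y : ℕ) := by
  rcases List.eq_nil_or_concat w with rfl | ⟨w, m, rfl⟩
  · simp [shuffleSumRight, shuffles, evalWord, letter, he.nil]
  · have h1 := evalWord_map_inl he (m :: w.reverse)
    have h2 : (1 : Series B) (w ++ [m]) = 0 := by cases w <;> rfl
    simp only [List.reverse_cons, List.reverse_reverse, List.map_cons] at h1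
    simp only [shuffleSumRight, List.concat_eq_append, List.reverse_append, List.reverse_cons,
      List.reverse_nil, List.nil_append, List.singleton_append, shuffles_nil_right, List.map_cons,
      List.map_nil, List.sum_cons, List.sum_nil, add_zero, Series.add_apply, h2, zero_add,
      Splitting.series_p_apply, ← h1]
    rfl

/-- The recursion `IsEll` condensed into one identity, e = W ∑ L^m t_m. -/
theorem dressing_mul_powers : (1 - s.series.n e) * Series.powers L = e := by
  ext w
  rcases List.eq_nil_or_concat w with rfl | ⟨w, m, rfl⟩
  · simp [he.nil]
  · rw [List.concat_eq_append, Series.mul_powers_append]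
    rcases w with _ | ⟨a, w⟩
    · simp [he.nil, he.singleton]
    · rw [he.append _ _ (by simp)]
      simp

/-- A factorization of 1 + ∑ L^m t_m as W⁻¹ V, adapted to the splitting. -/
theorem dressing_mul_one_add_powers :
    (1 - s.series.n e) * (1 + Series.powers L) = 1 + s.series.p e := by
  rw [mul_add, dressing_mul_powers he, mul_one]
  nth_rw 2 [← s.series.p_add_n e]
  abel

omit he

/-- Both halves are closed under multiplication, and W is 1 plus a negative element: right
multiplication by W preserves the negative half. The same holds for V and the nonnegative half
below. -/
theorem Splitting.n_mul_dressing (X y : B) : s.n (s.n X * (1 - s.n y)) = s.n X * (1 - s.n y) := by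
  rw [mul_sub, mul_one, map_sub, s.n_n, s.n_eq (s.n X * s.n y), s.p_n_mul_n, sub_zero]

theorem Splitting.p_mul_dressing (X y : B) : s.p (s.n X * (1 - s.n y)) = 0 := by
  rw [← s.n_mul_dressing, s.p_n]

theorem Splitting.n_p_mul_one_add (X y : B) : s.n (s.p X * (1 + s.p y)) = 0 := by
  rw [mul_add, mul_one, map_add, s.n_p, s.n_p_mul_p, add_zero]

include he

/-- By `shuffleSumLeft_cons`, the left sums F solve F = -(X V + F)_{<0} ∑ L^m t_m, which determines
F by recursion on the word. The stated series is the solution. -/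
theorem shuffleSumLeft_eq (y : ℕ+) (b : List ℕ+) (X : Series B)
    (hX : ∀ w : List ℕ+, shuffleSumRight s L y b w.reverse = (X * (1 + s.series.p e)) w)
    (w : List ℕ+) :
    shuffleSumLeft s L (y :: b) w.reverse =
      (-(s.series.n X * (1 - s.series.n e) * Series.powers L)) w := by
  have hE : (1 - s.series.n e) * Series.powers L = (1 + s.series.p e) - (1 - s.series.n e) := by
    rw [← dressing_mul_one_add_powers he]
    noncomm_ring
  -- As W ∑ L^m t_m = V - W, the argument of the projection equals X_{≥0} V + X_{<0} W.
  have key : s.series.n (X * (1 + s.series.p e) +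
      -(s.series.n X * (1 - s.series.n e) * Series.powers L)) =
        s.series.n X * (1 - s.series.n e) := by
    have : X * (1 + s.series.p e) + -(s.series.n X * (1 - s.series.n e) * Series.powers L) =
        s.series.p X * (1 + s.series.p e) + s.series.n X * (1 - s.series.n e) := by
      nth_rw 1 [← s.series.p_add_n X]
      rw [mul_assoc (s.series.n X), hE]
      noncomm_ring
    rw [this, map_add, s.series.n_p_mul_one_add, s.series.n_mul_dressing, zero_add]
  induction w using List.reverseRecOn with
  | nil => simp [shuffleSumLeft]
  | append_singleton w m ih =>
    rw [List.reverse_append, List.reverse_singleton, List.singleton_append, shuffleSumLeft_cons,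
      shuffleSum_cons, hX, ih, Series.neg_apply _ (w ++ [m]), Series.mul_powers_append,
      ← congrFun key w, neg_mul]
    rfl

/-- The sum over all shuffles in terms of a multiplicative map `H` with `H L = W L W⁻¹`, where
`W = 1 - ∑_w ℓ(P_w)_{<0} t_w`. -/
theorem shuffleSum_eq (H : B →+* Series B) (hn : ∀ x, H (s.n x) = s.series.n (H x))
    (hL : H L * (1 - s.series.n e) = (1 - s.series.n e) * Series.const L) (b : List ℕ+)
    (hb : b ≠ []) (w : List ℕ+) :
    shuffleSum s L w.reverse b =
      (s.series.p (H (e b.reverse)) * (1 + s.series.p e) +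
        s.series.n (H (e b.reverse)) * (1 - s.series.n e)) w := by
  -- V = W (1 + ∑ L^m t_m), whose second factor commutes with L; so V intertwines H(L) and L just as
  -- W does.
  have hV : ∀ n : ℕ, H (L ^ n) * (1 + s.series.p e) = (1 + s.series.p e) * Series.const (L ^ n) := by
    have h1 : H L * (1 + s.series.p e) = (1 + s.series.p e) * Series.const L := by
      rw [← dressing_mul_one_add_powers he, ← mul_assoc, hL, mul_assoc, mul_assoc, mul_add,
        add_mul, Series.powers_mul_const, mul_one, one_mul]
    intro n
    induction n with
    | zero =>
      rw [pow_zero, map_one, one_mul]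
      exact (mul_one _).symm
    | succ n ih =>
      rw [pow_succ, map_mul, mul_assoc, h1, ← mul_assoc, ih, mul_assoc, Series.const_mul_const]
  have hE : (1 - s.series.n e) * Series.powers L = (1 + s.series.p e) - (1 - s.series.n e) := by
    rw [← dressing_mul_one_add_powers he]
    noncomm_ring
  -- Shuffles ending in a letter of the second word give X V; the induction builds that word up
  -- letter by letter.
  have main : ∀ (b : List ℕ+) (y : ℕ+) (w : List ℕ+), shuffleSumRight s L y b w.reverse =
      (H (e (y :: b).reverse) * (1 + s.series.p e)) w := by
    intro b
    induction b with
    | nil =>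
      intro y w
      rw [shuffleSumRight_nil he, List.reverse_singleton, he.singleton, hV, Series.mul_const_apply]
    | cons z b ih =>
      intro y w
      set X := H (e (z :: b).reverse) with hX
      -- The two parts of `shuffleSumRight_cons` are the two projections of -X_{<0} V, so they
      -- recombine.
      have h1 : s.series.p (-(s.series.n X * (1 - s.series.n e) * Series.powers L)) -
          s.series.n (X * (1 + s.series.p e)) = -(s.series.n X * (1 + s.series.p e)) := by
        have h2 : s.series.n (X * (1 + s.series.p e)) =
            s.series.n (s.series.n X * (1 + s.series.p e)) := by
          nth_rw 1 [← s.series.p_add_n X]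
          rw [add_mul, map_add, s.series.n_p_mul_one_add, zero_add]
        rw [mul_assoc, hE, mul_sub, map_neg, map_sub, s.series.p_mul_dressing, h2, sub_zero,
          ← neg_add', s.series.p_add_n]
      have h2 : H (e (y :: z :: b).reverse) * (1 + s.series.p e) =
          -(s.series.n X * (1 + s.series.p e)) * Series.const (L ^ (y : ℕ)) := by
        rw [List.reverse_cons, he.append _ _ (by simp), map_mul, map_neg, hn, ← hX, mul_assoc, hV,
          ← mul_assoc, neg_mul]
      rw [h2, Series.mul_const_apply, ← h1, shuffleSumRight_cons,
        shuffleSumLeft_eq he z b X (ih z), ih z]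
      rfl
  obtain ⟨y, b, rfl⟩ := List.exists_cons_of_ne_nil hb
  rw [shuffleSum_cons, shuffleSumLeft_eq he y b _ (main b y), main, ← Series.add_apply]
  refine congrFun (?_ : (_ : Series B) = _) w
  -- X V - X_{<0} (V - W) = X_{≥0} V + X_{<0} W.
  nth_rw 1 [← s.series.p_add_n (H (e (y :: b).reverse))]
  rw [mul_assoc (s.series.n _), hE]
  noncomm_ring

end Evaluation

end NCKP

namespace NCKP

/-! ## The ring of pseudo-differential operators -/

section PsiRing

variable {K : Type*} [Field K] {A : Type*} [Ring A] [Algebra K A]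

/-- `X` contains only powers of `∂` with exponent at most `N`. -/
def OrderLE (N : ℤ) (X : PsiDO K A) : Prop := ∀ i, N < i → X.1 i = 0

theorem exists_orderLE (X : PsiDO K A) : ∃ N, OrderLE N X := X.2

theorem OrderLE.mul {N M : ℤ} {X Y : PsiDO K A} (d : A →ₗ[K] A) (hX : OrderLE N X)
    (hY : OrderLE M Y) : OrderLE (N + M) (mul d X Y) := by
  intro n hn
  refine finsum_eq_zero_of_forall_eq_zero fun p => ?_
  by_cases h : N < p.1
  · simp [hX _ h]
  · simp [hY (n - p.1 + p.2) (by omega)]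

/-- Linear maps which raise the order by a bounded amount are determined by their values on the
operators `a ∂^i`. -/
theorem eq_of_eq_on_monomial {F G : PsiDO K A →ₗ[K] PsiDO K A} (c : ℤ)
    (hF : ∀ N X, OrderLE N X → OrderLE (N + c) (F X))
    (hG : ∀ N X, OrderLE N X → OrderLE (N + c) (G X))
    (h : ∀ i a, F (monomial i a) = G (monomial i a)) (X : PsiDO K A) : F X = G X := by
  refine Subtype.ext (funext fun n => ?_)
  obtain ⟨N, hN⟩ := exists_orderLE X
  -- Cutting at n - c leaves a remainder too low in order for its image to reach ∂^n.
  set S : PsiDO K A := ∑ i ∈ Finset.Icc (n - c) N, monomial i (X.1 i) with hS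
  have hX : OrderLE (n - c - 1) (X - S) := by
    intro i hi
    have h1 : S.1 i = X.1 i := by
      rw [hS, Submodule.coe_sum, Finset.sum_apply]
      by_cases hi' : i ≤ N
      · rw [Finset.sum_eq_single i]
        · simp [monomial]
        · intro j _ hj
          simp [monomial, hj.symm]
        · intro hj
          exact absurd (Finset.mem_Icc.2 ⟨by omega, hi'⟩) hj
      · rw [hN i (by omega)]
        refine Finset.sum_eq_zero fun j hj => ?_
        have : i ≠ j := by
          rw [Finset.mem_Icc] at hj
          omega
        simp [monomial, this]
    change X.1 i - S.1 i = 0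
    rw [h1, sub_self]
  have hSF : F S = G S := by
    rw [hS, map_sum, map_sum]
    exact Finset.sum_congr rfl fun i _ => h i _
  have h1 : (F (X - S)).1 n = (G (X - S)).1 n := by
    rw [hF _ _ hX n (by omega), hG _ _ hX n (by omega)]
  rw [map_sub, map_sub, hSF] at h1
  exact sub_left_injective h1

/-- The cutoff `t` is left free, so that different expansions can be matched term by term. -/
theorem mul_monomial_apply (d : A →ₗ[K] A) {Y : PsiDO K A} {M : ℤ} (hY : OrderLE M Y) (i : ℤ)
    (a : A) (n : ℤ) (t : ℕ) (ht : M - n + i < t) :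
    (mul d (monomial i a) Y).1 n =
      ∑ k ∈ Finset.range t, Ring.choose i k • (a * (d ^ k) (Y.1 (n - i + k))) := by
  change mulCoeff d (monomial (K := K) i a).1 Y.1 n = _
  rw [mulCoeff, finsum_eq_sum_of_support_subset (s := {i} ×ˢ Finset.range t), Finset.sum_product,
    Finset.sum_singleton]
  · simp [monomial]
  · rintro ⟨p, k⟩ h
    simp only [Finset.coe_product, Finset.coe_singleton, Finset.coe_range, Set.mem_prod,
      Set.mem_singleton_iff, Set.mem_Iio]
    by_contra hpk
    refine h ?_
    by_cases hp : p = i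
    · have hk : t ≤ k := by
        by_contra hk
        exact hpk ⟨hp, by omega⟩
      simp [hY (n - p + k) (by omega)]
    · simp [monomial, hp]

/-- Multiplication of the coefficients by `a` from the left. -/
def lsmul (a : A) : PsiDO K A →ₗ[K] PsiDO K A := mapCoeff (LinearMap.mulLeft K a)

theorem lsmul_apply (a : A) (X : PsiDO K A) (i : ℤ) : (lsmul a X).1 i = a * X.1 i := rfl

theorem mul_monomial (d : A →ₗ[K] A) (i : ℤ) (a : A) (Y : PsiDO K A) :
    mul d (monomial i a) Y = lsmul a (mul d (monomial i 1) Y) := by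
  refine Subtype.ext (funext fun n => ?_)
  obtain ⟨M, hM⟩ := exists_orderLE Y
  have ht : M - n + i < ((M - n + i + 1).toNat : ℤ) := by omega
  rw [lsmul_apply, mul_monomial_apply d hM i a n _ ht, mul_monomial_apply d hM i 1 n _ ht,
    Finset.mul_sum]
  exact Finset.sum_congr rfl fun k _ => by rw [one_mul, mul_smul_comm]

theorem mul_lsmul (d : A →ₗ[K] A) (a : A) (X Y : PsiDO K A) :
    mul d (lsmul a X) Y = lsmul a (mul d X Y) := by
  refine Subtype.ext (funext fun n => ?_)
  change mulCoeff d (lsmul a X).1 Y.1 n = a * mulCoeff d X.1 Y.1 n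
  rw [mulCoeff, mulCoeff, mul_finsum' _ _ (mulCoeff_support d X Y n)]
  exact finsum_congr fun p => by rw [lsmul_apply, mul_assoc, mul_smul_comm]

theorem monomial_zero_one_mul (d : A →ₗ[K] A) (Y : PsiDO K A) : mul d (monomial 0 1) Y = Y := by
  refine Subtype.ext (funext fun n => ?_)
  obtain ⟨M, hM⟩ := exists_orderLE Y
  rw [mul_monomial_apply d hM 0 1 n ((M - n).toNat + 1) (by omega), Finset.sum_range_succ',
    Finset.sum_eq_zero]
  · simp
  · intro k _
    rw [Ring.choose_zero_succ, zero_smul]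

/-- Multiplication by `∂` from the left. -/
def del (d : A →ₗ[K] A) : PsiDO K A →ₗ[K] PsiDO K A where
  toFun X := ⟨fun n => d (X.1 n) + X.1 (n - 1), by
    obtain ⟨N, hN⟩ := X.2
    exact ⟨N + 1, fun i hi => by simp [hN i (by omega), hN (i - 1) (by omega)]⟩⟩
  map_add' X Y := by ext n; simp [add_add_add_comm]
  map_smul' c X := by ext n; simp

theorem del_apply (d : A →ₗ[K] A) (X : PsiDO K A) (n : ℤ) :
    (del d X).1 n = d (X.1 n) + X.1 (n - 1) := rfl

theorem OrderLE.del {N : ℤ} {X : PsiDO K A} (d : A →ₗ[K] A) (hX : OrderLE N X) :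
    OrderLE (N + 1) (del d X) := by
  intro i hi
  simp [del_apply, hX i (by omega), hX (i - 1) (by omega)]

/-- If ∂X = 0, the coefficients of X vanish successively from the top. This gives access to negative
powers of ∂. -/
theorem del_injective (d : A →ₗ[K] A) : Function.Injective (del (K := K) d) := by
  rw [injective_iff_map_eq_zero]
  intro X hX
  obtain ⟨N, hN⟩ := exists_orderLE X
  have key : ∀ k : ℕ, ∀ i, N - k < i → X.1 i = 0 := by
    intro k
    induction k with
    | zero => exact fun i hi => hN i (by simpa using hi)
    | succ k ih =>
      intro i hi
      have h1 : d (X.1 (i + 1)) + X.1 (i + 1 - 1) = 0 := congrFun (congrArg Subtype.val hX) (i + 1)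
      rwa [ih (i + 1) (by push_cast at hi; omega), map_zero, zero_add, add_sub_cancel_right] at h1
  exact Subtype.ext (funext fun i => key (N - i + 1).toNat i (by omega))

/-- Pascal's rule for the binomial coefficients. -/
theorem mul_monomial_add_one (d : A →ₗ[K] A) (i : ℤ) (Y : PsiDO K A) :
    mul d (monomial (i + 1) 1) Y = del d (mul d (monomial i 1) Y) := by
  refine Subtype.ext (funext fun n => ?_)
  obtain ⟨M, hM⟩ := exists_orderLE Y
  set t := (M - n + i + 1).toNat with ht
  rw [del_apply, mul_monomial_apply d hM i 1 n t (by omega),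
    mul_monomial_apply d hM i 1 (n - 1) (t + 1) (by omega),
    mul_monomial_apply d hM (i + 1) 1 n (t + 1) (by omega), Finset.sum_range_succ',
    Finset.sum_range_succ' _ t, map_sum, ← add_assoc, ← Finset.sum_add_distrib]
  congr 1
  · refine Finset.sum_congr rfl fun k _ => ?_
    rw [Ring.choose_succ_succ, add_smul, one_mul, one_mul, map_zsmul, pow_succ', Module.End.mul_apply,
      show n - (i + 1) + ((k + 1 : ℕ) : ℤ) = n - i + k by push_cast; ring,
      show n - 1 - i + ((k + 1 : ℕ) : ℤ) = n - i + k by push_cast; ring, one_mul,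
      Module.End.mul_apply]
  · rw [Ring.choose_zero_right, Ring.choose_zero_right, show n - (i + 1) = n - 1 - i by ring]

/-! ### Associativity and the splitting for a derivation -/

section Derivation

variable {d : A →ₗ[K] A} (hd : ∀ a b, d (a * b) = d a * b + a * d b)

include hd

theorem map_one_eq_zero : d 1 = 0 := by simpa using hd 1 1

theorem del_lsmul (a : A) (X : PsiDO K A) :
    del d (lsmul a X) = lsmul (d a) X + lsmul a (del d X) := by
  refine Subtype.ext (funext fun n => ?_)
  change d (a * X.1 n) + a * X.1 (n - 1) = d a * X.1 n + a * (d (X.1 n) + X.1 (n - 1))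
  rw [hd, mul_add, add_assoc]

theorem del_mul (X Y : PsiDO K A) : mul d (del d X) Y = del d (mul d X Y) := by
  obtain ⟨M, hM⟩ := exists_orderLE Y
  refine eq_of_eq_on_monomial (F := (mul d).flip Y ∘ₗ del d) (G := del d ∘ₗ (mul d).flip Y) (M + 1)
    (fun N X hX => ?_) (fun N X hX => ?_) (fun i a => ?_) X
  · rw [show N + (M + 1) = N + 1 + M by ring]
    exact (hX.del d).mul d hM
  · rw [← add_assoc]
    exact (hX.mul d hM).del d
  · change mul d (del d (monomial i a)) Y = del d (mul d (monomial i a) Y)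
    have h : del d (monomial i a) = monomial i (d a) + monomial (i + 1) a := by
      refine Subtype.ext (funext fun n => ?_)
      change d (if n = i then a else 0) + (if n - 1 = i then a else 0) =
        (if n = i then d a else 0) + if n = i + 1 then a else 0
      simp only [sub_eq_iff_eq_add, apply_ite d, map_zero]
    rw [h, map_add, LinearMap.add_apply, mul_monomial d i (d a), mul_monomial d (i + 1) a,
      mul_monomial_add_one, mul_monomial d i a, del_lsmul hd]

/-- Reduction to X = ∂^i, then induction on i: upwards because left multiplication by ∂ is
associative, downwards by cancelling an injective ∂. -/
theorem psi_mul_assoc (X Y Z : PsiDO K A) : mul d (mul d X Y) Z = mul d X (mul d Y Z) := by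
  obtain ⟨M, hM⟩ := exists_orderLE Y
  obtain ⟨R, hR⟩ := exists_orderLE Z
  refine eq_of_eq_on_monomial (F := (mul d).flip Z ∘ₗ (mul d).flip Y)
    (G := (mul d).flip (mul d Y Z)) (M + R)
    (fun N X hX => ?_) (fun N X hX => ?_) (fun i a => ?_) X
  · rw [← add_assoc]
    exact (hX.mul d hM).mul d hR
  · exact hX.mul d (hM.mul d hR)
  · change mul d (mul d (monomial i a) Y) Z = mul d (monomial i a) (mul d Y Z)
    rw [mul_monomial d i a, mul_monomial d i a, mul_lsmul]
    congr 1
    induction i using Int.induction_on with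
    | zero => rw [monomial_zero_one_mul, monomial_zero_one_mul]
    | succ i ih => rw [mul_monomial_add_one, mul_monomial_add_one, del_mul hd, ih]
    | pred i ih =>
      apply del_injective d
      rw [← del_mul hd, ← mul_monomial_add_one, ← mul_monomial_add_one, sub_add_cancel, ih]

theorem pow_apply_ite (k : ℕ) (q : Prop) [Decidable q] :
    (d ^ (k + 1)) (if q then 1 else 0) = 0 := by
  rw [pow_succ, Module.End.mul_apply]
  split_ifs <;> simp [map_one_eq_zero hd]

/-- Right multiplication by `∂^j`. -/
theorem mul_monomial_one_apply (X : PsiDO K A) (j n : ℤ) :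
    (mul d X (monomial j 1)).1 n = X.1 (n - j) := by
  change mulCoeff d X.1 (monomial (K := K) j (1 : A)).1 n = _
  rw [mulCoeff, finsum_eq_single _ ((n - j : ℤ), (0 : ℕ))]
  · simp [monomial]
  · rintro ⟨p, k⟩ hp
    change Ring.choose p k • (X.1 p * (d ^ k) (if n - p + k = j then 1 else 0)) = 0
    rcases k with _ | k
    · have : n - p ≠ j := fun h => hp (Prod.ext (by simp only; omega) rfl)
      simp [this]
    · rw [pow_apply_ite hd, mul_zero, smul_zero]

theorem mul_monomial_zero_one (X : PsiDO K A) : mul d X (monomial 0 1) = X := by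
  refine Subtype.ext (funext fun n => ?_)
  rw [mul_monomial_one_apply hd, sub_zero]

theorem monomial_one_mul_monomial_one (i j : ℤ) :
    mul d (monomial i 1) (monomial j 1) = monomial (K := K) (i + j) (1 : A) := by
  refine Subtype.ext (funext fun n => ?_)
  rw [mul_monomial_one_apply hd]
  change (if n - j = i then (1 : A) else 0) = if n = i + j then 1 else 0
  simp only [sub_eq_iff_eq_add]

omit hd

/-- The ring of pseudo-differential operators. -/
@[reducible] noncomputable def psiRing (hd : ∀ a b, d (a * b) = d a * b + a * d b) :
    Ring (PsiDO K A) :=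
  { (inferInstance : AddCommGroup (PsiDO K A)) with
    mul := fun X Y => mul d X Y
    one := monomial 0 1
    mul_assoc := psi_mul_assoc hd
    one_mul := monomial_zero_one_mul d
    mul_one := mul_monomial_zero_one hd
    left_distrib := fun X Y Z => map_add (mul d X) Y Z
    right_distrib := fun X Y Z => by
      change mul d (X + Y) Z = mul d X Z + mul d Y Z
      rw [map_add, LinearMap.add_apply]
    zero_mul := fun X => by
      change mul d 0 X = 0
      rw [map_zero, LinearMap.zero_apply]
    mul_zero := fun X => map_zero (mul d X) }

theorem pos_apply (X : PsiDO K A) (i : ℤ) : (pos X).1 i = if 0 ≤ i then X.1 i else 0 := rfl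

theorem neg_apply (X : PsiDO K A) (i : ℤ) : (neg X).1 i = if i < 0 then X.1 i else 0 := rfl

theorem OrderLE.neg (X : PsiDO K A) : OrderLE (-1) (neg X) := by
  intro i hi
  rw [neg_apply, if_neg (by omega)]

theorem OrderLE.pos_eq_zero {X : PsiDO K A} (hX : OrderLE (-1) X) : pos X = 0 := by
  refine Subtype.ext (funext fun i => ?_)
  rw [pos_apply]
  split_ifs with h
  · exact hX i (by omega)
  · rfl

/-- Reaching a negative power from ∂^p with p ≥ 0 requires k > p derivatives, and then the binomial
coefficient is zero. -/
theorem neg_mul_pos_pos (d : A →ₗ[K] A) (X Y : PsiDO K A) : neg (mul d (pos X) (pos Y)) = 0 := by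
  refine Subtype.ext (funext fun n => ?_)
  rw [neg_apply]
  split_ifs with hn
  · refine finsum_eq_zero_of_forall_eq_zero fun ⟨p, k⟩ => ?_
    simp only [pos_apply]
    by_cases hp : 0 ≤ p
    · by_cases hk : 0 ≤ n - p + k
      · obtain ⟨q, rfl⟩ := Int.eq_ofNat_of_zero_le hp
        rw [Ring.choose_natCast, Nat.choose_eq_zero_of_lt (by omega), Nat.cast_zero, zero_smul]
      · simp [hk]
    · simp [hp]
  · rfl

/-- The splitting of the ring of pseudo-differential operators. -/
noncomputable def psiSplitting (hd : ∀ a b, d (a * b) = d a * b + a * d b) :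
    @Splitting (PsiDO K A) (psiRing hd) :=
  letI := psiRing hd
  { p := (pos : PsiDO K A →ₗ[K] PsiDO K A).toAddMonoidHom
    n := (neg : PsiDO K A →ₗ[K] PsiDO K A).toAddMonoidHom
    p_add_n := pos_add_neg
    p_n := fun X => (OrderLE.neg X).pos_eq_zero
    p_one := by
      refine Subtype.ext (funext fun i => ?_)
      change (if 0 ≤ i then (if i = 0 then (1 : A) else 0) else 0) = if i = 0 then 1 else 0
      split_ifs <;> first | rfl | omega
    n_p_mul_p := neg_mul_pos_pos d
    p_n_mul_n := fun X Y => by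
      refine OrderLE.pos_eq_zero fun i hi => ?_
      exact ((OrderLE.neg X).mul d (OrderLE.neg Y)) i (by omega) }

end Derivation

theorem mapCoeff_apply (f : A →ₗ[K] A) (X : PsiDO K A) (i : ℤ) :
    (mapCoeff f X).1 i = f (X.1 i) := rfl

theorem mapCoeff_pos (f : A →ₗ[K] A) (X : PsiDO K A) : mapCoeff f (pos X) = pos (mapCoeff f X) := by
  refine Subtype.ext (funext fun i => ?_)
  simp only [mapCoeff_apply, pos_apply, apply_ite f, map_zero]

theorem mapCoeff_neg (f : A →ₗ[K] A) (X : PsiDO K A) : mapCoeff f (neg X) = neg (mapCoeff f X) := by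
  refine Subtype.ext (funext fun i => ?_)
  simp only [mapCoeff_apply, neg_apply, apply_ite f, map_zero]

theorem mapCoeff_monomial (f : A →ₗ[K] A) (i : ℤ) (a : A) :
    mapCoeff f (monomial i a) = monomial i (f a) := by
  refine Subtype.ext (funext fun j => ?_)
  change f (if j = i then a else 0) = if j = i then f a else 0
  simp only [apply_ite f, map_zero]

/-- Families of coefficient maps with a deformed Leibniz rule extend to pseudo-differential
operators. -/
theorem mapCoeff_mul {ι : Type*} (s : Finset ι) {d : A →ₗ[K] A} (f : A →ₗ[K] A)
    (g h : ι → A →ₗ[K] A) (hf : ∀ a b, f (a * b) = ∑ j ∈ s, g j a * h j b)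
    (hh : ∀ j a, h j (d a) = d (h j a)) (X Y : PsiDO K A) :
    mapCoeff f (mul d X Y) = ∑ j ∈ s, mul d (mapCoeff (g j) X) (mapCoeff (h j) Y) := by
  have hk : ∀ (k : ℕ) j a, h j ((d ^ k) a) = (d ^ k) (h j a) := by
    intro k j
    induction k with
    | zero => simp
    | succ k ih => intro a; rw [pow_succ, Module.End.mul_apply, Module.End.mul_apply, ih, hh]
  refine Subtype.ext (funext fun n => ?_)
  rw [Submodule.coe_sum, Finset.sum_apply]
  change f (mulCoeff d X.1 Y.1 n) =
    ∑ j ∈ s, mulCoeff d (mapCoeff (g j) X).1 (mapCoeff (h j) Y).1 n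
  unfold mulCoeff
  rw [← finsum_sum_comm _ _ fun j _ => mulCoeff_support d (mapCoeff (g j) X) (mapCoeff (h j) Y) n]
  refine (f.toAddMonoidHom.map_finsum (mulCoeff_support d X Y n)).trans (finsum_congr fun p => ?_)
  change f _ = _
  rw [map_zsmul, hf, Finset.smul_sum]
  exact Finset.sum_congr rfl fun j _ => by rw [hk]; rfl

end PsiRing

end NCKP

namespace NCKP

/-! ## The mixable shuffle product -/

section ShuffleSum

/-- The filtered list contains each element of `Fin m`, in order of appearance; a strictly
increasing list is determined by its members. -/
theorem strictMono_iff_filterMap_ofFn {N m : ℕ} {γ : Type*} (σ : Fin N ≃ γ) (ι : Fin m → γ)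
    (g : γ → Option (Fin m)) (hg : ∀ x i, g x = some i ↔ ι i = x) :
    StrictMono (fun i => σ.symm (ι i)) ↔ (List.ofFn σ).filterMap g = List.finRange m := by
  have hinj : Function.Injective ι := fun i j h => by
    have h1 := (hg (ι j) i).2 h
    rw [(hg (ι j) j).2 rfl] at h1
    exact (Option.some_injective _ h1).symm
  constructor
  · intro h
    refine List.Pairwise.eq_of_mem_iff (r := (· < ·)) ?_ (List.sortedLT_finRange m).pairwise ?_
    · rw [List.pairwise_filterMap, List.pairwise_ofFn]
      intro p q hpq i hi j hj
      rw [hg] at hi hj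
      rw [← h.lt_iff_lt, hi, hj]
      simpa using hpq
    · intro i
      simp only [List.mem_filterMap, List.mem_finRange, iff_true]
      exact ⟨ι i, by simp [List.mem_ofFn, σ.surjective (ι i)], (hg _ _).2 rfl⟩
  · intro h i j hij
    have h1 : ((List.ofFn σ).filterMap g).Pairwise (· < ·) := by
      rw [h]
      exact (List.sortedLT_finRange m).pairwise
    rw [List.pairwise_filterMap, List.pairwise_ofFn] at h1
    by_contra hlt
    have hne : σ.symm (ι j) ≠ σ.symm (ι i) := fun h2 => hij.ne (hinj (σ.symm.injective h2)).symm
    exact lt_asymm hij (h1 (lt_of_le_of_ne (not_lt.1 hlt) hne) j (by simp [hg]) i (by simp [hg]))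

theorem mem_Shuff_iff {m n : ℕ} (σ : Fin (m + n) ≃ Fin m ⊕ Fin n) :
    σ ∈ Shuff m n ↔ (List.ofFn σ).filterMap Sum.getLeft? = List.finRange m ∧
      (List.ofFn σ).filterMap Sum.getRight? = List.finRange n := by
  rw [Shuff, Finset.mem_filter, and_iff_right (Finset.mem_univ _),
    strictMono_iff_filterMap_ofFn σ Sum.inl Sum.getLeft? (by rintro (x | x) i <;> simp [eq_comm]),
    strictMono_iff_filterMap_ofFn σ Sum.inr Sum.getRight? (by rintro (x | x) i <;> simp [eq_comm])]

theorem length_eq_add_of_sum {α β : Type*} (l : List (α ⊕ β)) :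
    l.length = (l.filterMap Sum.getLeft?).length + (l.filterMap Sum.getRight?).length := by
  induction l with
  | nil => rfl
  | cons t l ih =>
    cases t <;> simp only [List.filterMap_cons, Sum.getLeft?_inl, Sum.getLeft?_inr,
      Sum.getRight?_inl, Sum.getRight?_inr, List.length_cons] <;> omega

theorem exists_equiv_of_filterMap {m n : ℕ} (l : List (Fin m ⊕ Fin n))
    (h1 : l.filterMap Sum.getLeft? = List.finRange m)
    (h2 : l.filterMap Sum.getRight? = List.finRange n) :
    ∃ σ : Fin (m + n) ≃ Fin m ⊕ Fin n, List.ofFn σ = l := by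
  have hl : m + n = l.length := by
    rw [length_eq_add_of_sum, h1, h2, List.length_finRange, List.length_finRange]
  have hmem : ∀ x, x ∈ l := by
    rintro (i | j)
    · have h := List.mem_finRange i
      rw [← h1, List.mem_filterMap] at h
      obtain ⟨x, hx, hxi⟩ := h
      rwa [← Sum.getLeft?_eq_some_iff.1 hxi]
    · have h := List.mem_finRange j
      rw [← h2, List.mem_filterMap] at h
      obtain ⟨x, hx, hxi⟩ := h
      rwa [← Sum.getRight?_eq_some_iff.1 hxi]
  have hb : Function.Bijective fun k : Fin (m + n) => l.get (k.cast hl) := by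
    rw [Fintype.bijective_iff_surjective_and_card]
    refine ⟨fun x => ?_, by simp⟩
    obtain ⟨k, hk⟩ := List.get_of_mem (hmem x)
    exact ⟨k.cast hl.symm, by simpa using hk⟩
  refine ⟨Equiv.ofBijective _ hb, List.ext_getElem (by simp [hl]) fun k _ _ => ?_⟩
  simp

/-- Passes from permutations to recursively enumerated lists, reversed because ℓ peels letters off
on the right. -/
theorem sum_Shuff {M : Type*} [AddCommMonoid M] (m n : ℕ) (F : List (Fin m ⊕ Fin n) → M) :
    ∑ σ ∈ Shuff m n, F (List.ofFn σ).reverse =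
      ((shuffles (List.finRange m).reverse (List.finRange n).reverse).map F).sum := by
  rw [← List.sum_toFinset _ (nodup_shuffles _ _)]
  refine Finset.sum_bij (fun σ _ => (List.ofFn σ).reverse) ?_ ?_ ?_ fun _ _ => rfl
  · intro σ hσ
    rw [mem_Shuff_iff] at hσ
    rw [List.mem_toFinset, mem_shuffles, List.filterMap_reverse, List.filterMap_reverse, hσ.1, hσ.2]
    exact ⟨rfl, rfl⟩
  · intro σ _ τ _ h
    exact DFunLike.coe_injective (List.ofFn_injective (List.reverse_injective h))
  · intro l hl
    rw [List.mem_toFinset, mem_shuffles] at hl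
    obtain ⟨σ, hσ⟩ := exists_equiv_of_filterMap l.reverse
      (by rw [List.filterMap_reverse, hl.1, List.reverse_reverse])
      (by rw [List.filterMap_reverse, hl.2, List.reverse_reverse])
    refine ⟨σ, ?_, by rw [hσ, List.reverse_reverse]⟩
    rw [mem_Shuff_iff, hσ, List.filterMap_reverse, List.filterMap_reverse, hl.1, hl.2,
      List.reverse_reverse, List.reverse_reverse]
    exact ⟨rfl, rfl⟩

end ShuffleSum

/-! ### Mutual associativity of the products on A(P) -/

section Products

variable {K : Type*} [Field K]

theorem P_of_ne_nil {w : List ℕ+} (hw : w ≠ []) : P K w = Finsupp.single ⟨w, hw⟩ 1 := dif_pos hw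

/-- Linear maps on `A(P)` are determined by their values on the basis. -/
theorem AP_hom_ext {M : Type*} [AddCommGroup M] [Module K M] {f g : AP K →ₗ[K] M}
    (h : ∀ w : List ℕ+, w ≠ [] → f (P K w) = g (P K w)) : f = g := by
  refine Finsupp.lhom_ext' fun w => LinearMap.ext_ring ?_
  have := h w.1 w.2
  rwa [P_of_ne_nil w.2] at this

theorem bilin_P (f : Word → Word → AP K) {v w : List ℕ+} (hv : v ≠ []) (hw : w ≠ []) :
    bilin K f (P K v) (P K w) = f ⟨v, hv⟩ ⟨w, hw⟩ := by
  simp [bilin, P_of_ne_nil hv, P_of_ne_nil hw]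

theorem prec_P {v w : List ℕ+} (hv : v ≠ []) (hw : w ≠ []) :
    prec K (P K v) (P K w) = P K (v ++ w) := bilin_P _ hv hw

theorem bullet_P_cons (a c : ℕ+) (w : List ℕ+) :
    bullet K (P K [a]) (P K (c :: w)) = P K ((a + c) :: w) :=
  bilin_P _ (List.cons_ne_nil _ _) (List.cons_ne_nil _ _)

theorem bullet_P_append (w : List ℕ+) (c b : ℕ+) :
    bullet K (P K (w ++ [c])) (P K [b]) = P K (w ++ [c + b]) := by
  rw [bullet, bilin_P _ (by simp) (by simp)]
  simp

/-- The products `≺`, `•` are associative and mutually associative; here one of the outer factors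
on each side is a letter. -/
theorem letter_assoc (a b : ℕ+) (op₁ op₂ : AP K →ₗ[K] AP K →ₗ[K] AP K)
    (h₁ : op₁ = prec K ∨ op₁ = bullet K) (h₂ : op₂ = prec K ∨ op₂ = bullet K) (α : AP K) :
    op₁ (P K [a]) (op₂ α (P K [b])) = op₂ (op₁ (P K [a]) α) (P K [b]) := by
  refine LinearMap.congr_fun (f := op₁ (P K [a]) ∘ₗ op₂.flip (P K [b]))
    (g := op₂.flip (P K [b]) ∘ₗ op₁ (P K [a])) (AP_hom_ext fun w hw => ?_) α
  change op₁ (P K [a]) (op₂ (P K w) (P K [b])) = op₂ (op₁ (P K [a]) (P K w)) (P K [b])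
  obtain ⟨c, w, rfl⟩ := List.exists_cons_of_ne_nil hw
  rcases List.eq_nil_or_concat w with rfl | ⟨w, e, rfl⟩
  · have h3 : ∀ x y : ℕ+, bullet K (P K [x]) (P K [y]) = P K [x + y] := fun x y =>
      bullet_P_cons x y []
    rcases h₁ with rfl | rfl <;> rcases h₂ with rfl | rfl
    · simp [prec_P]
    · rw [h3, prec_P (by simp) (by simp), prec_P (by simp) (by simp), bullet_P_append]
    · rw [h3, prec_P (by simp) (by simp), prec_P (by simp) (by simp), List.singleton_append,
        bullet_P_cons]
      rfl
    · rw [h3, h3, h3, h3, add_assoc]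
  · rw [List.concat_eq_append, ← List.cons_append]
    rcases h₁ with rfl | rfl <;> rcases h₂ with rfl | rfl
    · simp [prec_P]
    · rw [bullet_P_append, prec_P (by simp) (by simp), prec_P (by simp) (by simp),
        ← List.append_assoc, ← List.append_assoc, bullet_P_append]
    · rw [prec_P (by simp) (by simp), List.cons_append, List.cons_append, bullet_P_cons,
        bullet_P_cons, prec_P (by simp) (by simp)]
      rfl
    · rw [bullet_P_append, List.cons_append, List.cons_append, bullet_P_cons, bullet_P_cons,
        ← List.cons_append, ← List.cons_append, bullet_P_append]

theorem link_assoc {m n : ℕ} (x y z t : Fin m ⊕ Fin n) (a b : ℕ+) (α : AP K) :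
    link K x y (P K [a]) (link K z t α (P K [b])) =
      link K z t (link K x y (P K [a]) α) (P K [b]) := by
  have h : ∀ x y : Fin m ⊕ Fin n, link K x y = prec K ∨ link K x y = succ K := by
    rintro (x | x) (y | y) <;> simp [link]
  have h1 := fun o₁ o₂ h₁ h₂ => letter_assoc (K := K) a b o₁ o₂ h₁ h₂ α
  rcases h x y with hx | hx <;> rcases h z t with hz | hz <;> rw [hx, hz] <;>
    simp only [succ, LinearMap.add_apply, map_add, h1 _ _ (Or.inl rfl) (Or.inl rfl),
      h1 _ _ (Or.inl rfl) (Or.inr rfl), h1 _ _ (Or.inr rfl) (Or.inl rfl),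
      h1 _ _ (Or.inr rfl) (Or.inr rfl)]
  abel

/-- `chain` brackets to the right, but ℓ is known on products with a letter on the right; mutual
associativity moves the brackets. -/
theorem chain_append {m n : ℕ} (f : Fin m ⊕ Fin n → ℕ+) (l : List (Fin m ⊕ Fin n))
    (t x : Fin m ⊕ Fin n) :
    chain K (fun s => P K [f s]) (link K) (l ++ [t, x]) =
      link K t x (chain K (fun s => P K [f s]) (link K) (l ++ [t])) (P K [f x]) := by
  induction l with
  | nil => rfl
  | cons a l ih =>
    rcases l with _ | ⟨b, l⟩
    · simp only [List.cons_append, List.nil_append, chain, link_assoc]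
    · simp only [List.cons_append, chain] at ih ⊢
      rw [ih, link_assoc]

end Products

/-! ### The values of ℓ on shuffle products -/

section EllCirc

variable {K : Type*} [Field K] {A : Type*} [Ring A] [Algebra K A] {d : A →ₗ[K] A}
  (hd : ∀ a b, d (a * b) = d a * b + a * d b) (u : ℕ → A)

include hd

theorem iterate_mul_eq (L X : PsiDO K A) (k : ℕ) :
    letI := psiRing hd
    (fun X => mul d X L)^[k] X = X * L ^ k := by
  let _ := psiRing hd
  induction k with
  | zero => exact (mul_one X).symm
  | succ k ih =>
    rw [Function.iterate_succ_apply', ih, pow_succ, ← mul_assoc]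
    rfl

theorem ellWord_singleton (m : ℕ+) :
    letI := psiRing hd
    ellWord d u [m] = Lax K u ^ (m : ℕ) := by
  let _ := psiRing hd
  rw [ellWord, iterate_mul_eq hd, ← pow_succ', Nat.sub_add_cancel m.pos]

theorem ellWord_cons_cons (m n : ℕ+) (w : List ℕ+) :
    letI := psiRing hd
    ellWord d u (m :: n :: w) = -neg (ellWord d u (n :: w)) * Lax K u ^ (m : ℕ) := by
  let _ := psiRing hd
  rw [ellWord, iterate_mul_eq hd]
  change -(neg (ellWord d u (n :: w)) * Lax K u) * Lax K u ^ ((m : ℕ) - 1) = _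
  rw [← neg_mul, mul_assoc, ← pow_succ', Nat.sub_add_cancel m.pos]

omit hd in
variable (d) in
/-- The series `∑_w ℓ(P_w) t_w`. -/
noncomputable def ellSeries : Series (PsiDO K A) := fun w => ell d u (P K w)

omit hd in
theorem ellSeries_apply (w : List ℕ+) : ellSeries d u w = ell d u (P K w) := rfl

theorem isEll_ell :
    letI := psiRing hd
    IsEll (psiSplitting hd) (Lax K u) (ellSeries d u) := by
  let _ := psiRing hd
  refine ⟨by simp [ellSeries_apply, ell_single, ellWord], fun m => ?_, fun w m hw => ?_⟩
  · rw [ellSeries_apply, ell_single]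
    exact ellWord_singleton hd u m
  · rw [ellSeries_apply, ellSeries_apply, ell_single, ell_single, List.reverse_append, List.reverse_singleton,
      List.singleton_append]
    obtain ⟨n, v, hv⟩ := List.exists_cons_of_ne_nil (by simpa using hw : w.reverse ≠ [])
    rw [hv]
    exact ellWord_cons_cons hd u m n v

theorem ell_prec_letter (α : AP K) (m : ℕ+) :
    letI := psiRing hd
    ell d u (prec K α (P K [m])) = -neg (ell d u α) * Lax K u ^ (m : ℕ) := by
  let _ := psiRing hd
  refine LinearMap.congr_fun (f := ell d u ∘ₗ (prec K).flip (P K [m]))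
    (g := -((mul d).flip (Lax K u ^ (m : ℕ)) ∘ₗ neg ∘ₗ ell d u)) (AP_hom_ext fun w hw => ?_) α
    |>.trans (neg_mul _ _).symm
  change ell d u (prec K (P K w) (P K [m])) = -(neg (ell d u (P K w)) * Lax K u ^ (m : ℕ))
  rw [prec_P hw (by simp), ← neg_mul]
  exact (isEll_ell hd u).append w m hw

theorem ell_bullet_letter (α : AP K) (m : ℕ+) :
    letI := psiRing hd
    ell d u (bullet K α (P K [m])) = ell d u α * Lax K u ^ (m : ℕ) := by
  let _ := psiRing hd
  refine LinearMap.congr_fun (f := ell d u ∘ₗ (bullet K).flip (P K [m]))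
    (g := (mul d).flip (Lax K u ^ (m : ℕ)) ∘ₗ ell d u) (AP_hom_ext fun w hw => ?_) α
  change ell d u (bullet K (P K w) (P K [m])) = ell d u (P K w) * Lax K u ^ (m : ℕ)
  obtain ⟨v, c, rfl⟩ := (List.eq_nil_or_concat w).resolve_left hw
  have he := isEll_ell hd u
  rw [List.concat_eq_append, bullet_P_append]
  by_cases hv : v = []
  · subst hv
    have h1 := he.singleton c
    have h2 := he.singleton (c + m)
    rw [PNat.add_coe, pow_add, ← h1] at h2
    exact h2
  · have h1 := he.append v c hv
    have h2 := he.append v (c + m) hv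
    rw [PNat.add_coe, pow_add, ← mul_assoc, ← h1] at h2
    exact h2

theorem ell_succ_letter (α : AP K) (m : ℕ+) :
    letI := psiRing hd
    ell d u (succ K α (P K [m])) = pos (ell d u α) * Lax K u ^ (m : ℕ) := by
  let _ := psiRing hd
  rw [succ, LinearMap.add_apply, LinearMap.add_apply, map_add, ell_prec_letter hd,
    ell_bullet_letter hd, ← add_mul]
  congr 1
  rw [neg_add_eq_sub, sub_eq_iff_eq_add, pos_add_neg]

theorem ell_chain {m n : ℕ} (f : Fin m → ℕ+) (g : Fin n → ℕ+) (l : List (Fin m ⊕ Fin n)) :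
    letI := psiRing hd
    ell d u (chain K (Sum.elim (fun i => P K [f i]) fun j => P K [g j]) (link K) l) =
      evalWord (psiSplitting hd) (Lax K u) (l.reverse.map (Sum.map f g)) := by
  let _ := psiRing hd
  have hA : (Sum.elim (fun i => P K [f i]) fun j => P K [g j]) =
      fun s => P K [Sum.elim f g s] := by
    ext1 s
    cases s <;> rfl
  rw [hA]
  obtain ⟨l, rfl⟩ : ∃ k, k.reverse = l := ⟨l.reverse, List.reverse_reverse l⟩
  rw [List.reverse_reverse]
  have hlet : ∀ x : Fin m ⊕ Fin n, ((Sum.elim f g x : ℕ+) : ℕ) = letter (Sum.map f g x) := by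
    rintro (x | x) <;> rfl
  induction l with
  | nil => exact map_zero _
  | cons x l ih =>
    rcases l with _ | ⟨t, l⟩
    · change ell d u (P K [Sum.elim f g x]) = Lax K u ^ letter (Sum.map f g x)
      rw [← hlet]
      exact (isEll_ell hd u).singleton _
    · have h1 : (x :: t :: l).reverse = l.reverse ++ [t, x] := by simp
      rw [List.reverse_cons] at ih
      rw [h1, chain_append]
      have h2 : ∀ α, ell d u (link K t x α (P K [Sum.elim f g x])) =
          linkProj (psiSplitting hd) (Sum.map f g t) (Sum.map f g x) (ell d u α) *
            Lax K u ^ letter (Sum.map f g x) := by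
        intro α
        rw [← hlet]
        rcases t with t | t <;> rcases x with x | x
        · exact ell_prec_letter hd u _ _
        · exact ell_succ_letter hd u _ _
        · exact ell_prec_letter hd u _ _
        · exact ell_prec_letter hd u _ _
      rw [h2, ih]
      rfl

theorem ell_circ {v w : List ℕ+} (hv : v ≠ []) (hw : w ≠ []) :
    letI := psiRing hd
    ell d u (circ K (P K v) (P K w)) =
      shuffleSum (psiSplitting hd) (Lax K u) v.reverse w.reverse := by
  let _ := psiRing hd
  rw [circ, bilin_P _ hv hw, map_sum]
  simp only [ell_chain hd]
  rw [sum_Shuff _ _ fun l => evalWord (psiSplitting hd) (Lax K u)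
    (l.map (Sum.map (fun i => v.get i) fun j => w.get j))]
  have h : ∀ x : List ℕ+, (List.finRange x.length).map (fun i => x.get i) = x := by
    intro x
    simp
  have h' : shuffleSum (psiSplitting hd) (Lax K u) v.reverse w.reverse =
      shuffleSum (psiSplitting hd) (Lax K u)
        ((List.finRange v.length).map fun i => v.get i).reverse
        ((List.finRange w.length).map fun i => w.get i).reverse := by
    rw [h, h]
  rw [h', shuffleSum, ← List.map_reverse, ← List.map_reverse, shuffles_map, List.map_map]
  rfl

end EllCirc

end NCKP

namespace NCKP

/-! ## Solutions of the hierarchy -/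

section Hierarchy

variable {K : Type*} [Field K] {A : Type*} [Ring A] [Algebra K A] {d : A →ₗ[K] A} {u : ℕ → A}

theorem OrderLE.apply_eq_zero {N n : ℤ} {X : PsiDO K A} (hX : OrderLE N X) (h : N < n) :
    X.1 n = 0 := hX n h

/-- Only proper prefixes enter, so the Lax equations are a recursion on length, for existence and
uniqueness alike. -/
theorem laxRHS_congr {D D' : List ℕ+ → PsiDO K A} {w : List ℕ+}
    (h : ∀ v : List ℕ+, v.length < w.length → D v = D' v) :
    laxRHS d u D w = laxRHS d u D' w := by
  rw [laxRHS, laxRHS]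
  congr 1
  refine Finset.sum_congr rfl fun j hj => ?_
  rw [Finset.mem_Ico] at hj
  rw [h _ (by rw [List.length_take]; omega)]

/-- The Lax equations, in terms of generating series, are `D = W L W⁻¹`. -/
theorem mul_dressing_of_lax (hd : ∀ a b, d (a * b) = d a * b + a * d b) {D : Series (PsiDO K A)}
    (h0 : D [] = Lax K u) (hD : ∀ w, w ≠ [] → D w = laxRHS d u D w) :
    letI := psiRing hd
    D * (1 - (psiSplitting hd).series.n (ellSeries d u)) =
      (1 - (psiSplitting hd).series.n (ellSeries d u)) * Series.const (Lax K u) := by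
  let _ := psiRing hd
  have he := isEll_ell hd u
  set e := ellSeries d u
  set s := psiSplitting hd
  ext1 w
  rw [Series.mul_const_apply, mul_sub, mul_one]
  rcases w with _ | ⟨m, w⟩
  · simp [he.nil, h0]
  · have h1 : ((1 : Series (PsiDO K A)) - s.series.n e) (m :: w) = -s.n (e (m :: w)) := by simp
    have h2 : (D * s.series.n e) (m :: w) = Lax K u * s.n (e (m :: w)) +
        ∑ j ∈ Finset.Ico 1 (m :: w).length, D ((m :: w).take j) * s.n (e ((m :: w).drop j)) := by
      rw [Series.mul_apply, Finset.sum_range_succ, Finset.range_eq_Ico,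
        Finset.sum_eq_sum_Ico_succ_bot (by simp), List.take_zero, List.drop_zero, h0,
        List.drop_length, Splitting.series_n_apply, Splitting.series_n_apply, he.nil, map_zero,
        mul_zero, add_zero]
      rfl
    have h3 : D (m :: w) = -(s.n (e (m :: w)) * Lax K u - Lax K u * s.n (e (m :: w))) +
        ∑ j ∈ Finset.Ico 1 (m :: w).length, D ((m :: w).take j) * s.n (e ((m :: w).drop j)) :=
      hD _ (List.cons_ne_nil _ _)
    rw [h1, Series.sub_apply, h2, h3]
    noncomm_ring

/-- Products of two operators of negative order do not reach ∂^{-1}, so only [∂, ℓ(P_w)_{<0}] is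
visible. For n ≥ 0 this shows that flows of L have negative order; n = -1 gives the flow of u_2. -/
theorem laxRHS_apply (hd : ∀ a b, d (a * b) = d a * b + a * d b) {D : List ℕ+ → PsiDO K A}
    {w : List ℕ+} (hD : ∀ v : List ℕ+, v ≠ [] → v.length < w.length → OrderLE (-1) (D v)) {n : ℤ}
    (hn : -1 ≤ n) : (laxRHS d u D w).1 n = d ((neg (ell d u (P K w))).1 n) := by
  set N := neg (ell d u (P K w))
  have hN : OrderLE (-1) N := OrderLE.neg _
  have hL : Lax K u = monomial 1 1 + neg (Lax K u) := by rw [← pos_lax, pos_add_neg]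
  have hNL : (mul d N (Lax K u)).1 n = N.1 (n - 1) := by
    rw [hL, map_add]
    change (mul d N (monomial 1 1)).1 n + (mul d N (neg (Lax K u))).1 n = _
    rw [mul_monomial_one_apply hd, (hN.mul d (OrderLE.neg _)).apply_eq_zero (by omega), add_zero]
  have hLN : (mul d (Lax K u) N).1 n = d (N.1 n) + N.1 (n - 1) := by
    rw [hL, map_add, LinearMap.add_apply]
    change (mul d (monomial 1 1) N).1 n + (mul d (neg (Lax K u)) N).1 n = _
    have h1 := mul_monomial_add_one d 0 N
    rw [monomial_zero_one_mul, zero_add] at h1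
    rw [h1, del_apply, ((OrderLE.neg _).mul d hN).apply_eq_zero (by omega), add_zero]
  rw [laxRHS]
  change -((mul d N (Lax K u)).1 n - (mul d (Lax K u) N).1 n) + (Finset.sum _ _ : PsiDO K A).1 n = _
  rw [Submodule.coe_sum, Finset.sum_apply, Finset.sum_eq_zero, hNL, hLN]
  · abel
  · intro j hj
    rw [Finset.mem_Ico] at hj
    have hlen : (w.take j).length = j := by rw [List.length_take]; omega
    refine ((hD (w.take j) ?_ (by omega)).mul d (OrderLE.neg _)).apply_eq_zero (by omega)
    intro h
    rw [h, List.length_nil] at hlen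
    omega

theorem lax_apply_neg_one : (Lax K u).1 (-1) = u 0 := by simp [Lax]

/-! ### Consequences of the deformed Leibniz rule and the Lax equations -/

namespace IsHierarchySolution

variable {T : List ℕ+ → A →ₗ[K] A} (h : IsHierarchySolution d u T)

include h

theorem map_one (w : List ℕ+) : T w 1 = (1 : Series A) w := by
  let E : Series A := fun w => T w 1
  have h1 : E = 1 := by
    refine Series.eq_one_of_mul_self ?_ (LinearMap.congr_fun h.nil 1)
    ext v
    have h2 := h.mul v 1 1
    rw [mul_one] at h2
    exact h2.symm
  exact congrFun h1 w

omit h in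
/-- `X ↦ ∑_w (∂_{t_w} X) t_w` as a ring homomorphism. -/
noncomputable def flowHom (h : IsHierarchySolution d u T) :
    letI := psiRing h.leibniz
    PsiDO K A →+* Series (PsiDO K A) :=
  letI := psiRing h.leibniz
  { toFun := fun X w => mapCoeff (T w) X
    map_one' := by
      ext1 w
      change mapCoeff (T w) (monomial 0 1) = _
      rw [mapCoeff_monomial, h.map_one]
      cases w with
      | nil => rfl
      | cons m w => exact map_zero _
    map_mul' := fun X Y => by
      ext1 w
      exact mapCoeff_mul _ (T w) (fun j => T (w.take j)) (fun j => T (w.drop j)) (h.mul w)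
        (fun j => h.comm _) X Y
    map_zero' := by
      ext1 w
      exact map_zero _
    map_add' := fun X Y => by
      ext1 w
      exact map_add (mapCoeff (T w)) X Y }

theorem flow_Phi_P {v w : List ℕ+} (hv : v ≠ []) (hw : w ≠ []) :
    T v (Phi d u (P K w)) = Phi d u (circ K (P K v) (P K w)) := by
  have hd := h.leibniz
  let _ := psiRing hd
  set s := psiSplitting hd
  set e := ellSeries d u
  set X := h.flowHom (e w)
  have h0 : mapCoeff (T []) (Lax K u) = Lax K u := by rw [h.nil]; rfl
  have key := shuffleSum_eq (isEll_ell hd u) h.flowHom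
    (fun x => by ext1 w; exact mapCoeff_neg (T w) x)
    (mul_dressing_of_lax hd (D := fun v => mapCoeff (T v) (Lax K u)) h0 h.lax) w.reverse
    (by simpa using hw) v
  rw [List.reverse_reverse, ← ell_circ hd u hv hw] at key
  -- X_{≥0} V has no negative powers of ∂.
  have h1 : res ((s.series.p X * (1 + s.series.p e)) v) = 0 := by
    have h2 : neg ((s.series.p X * (1 + s.series.p e)) v) = 0 :=
      congrFun (s.series.n_p_mul_one_add X e) v
    have h3 := congrFun (congrArg Subtype.val h2) (-1)
    rwa [neg_apply, if_pos (by norm_num)] at h3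
  have h4 : res ((s.series.n X * (1 - s.series.n e)) v) = T v (Phi d u (P K w)) := by
    rw [mul_sub, mul_one, Series.sub_apply, map_sub, Series.mul_apply, map_sum,
      Finset.sum_eq_zero, sub_zero]
    · rfl
    -- Each term of X_{<0} e_{<0} has order at most -2.
    · intro j _
      exact ((OrderLE.neg _).mul d (OrderLE.neg _)).apply_eq_zero (by norm_num)
  rw [← h4, Phi, LinearMap.comp_apply, key, Series.add_apply, map_add, h1, zero_add]

theorem flow_Phi {w : List ℕ+} (hw : w ≠ []) (α : AP K) :
    T w (Phi d u α) = Phi d u (circ K (P K w) α) :=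
  LinearMap.congr_fun (f := T w ∘ₗ Phi d u) (g := Phi d u ∘ₗ circ K (P K w))
    (AP_hom_ext fun _ hv => h.flow_Phi_P hw hv) α

theorem orderLE_flow {w : List ℕ+} (hw : w ≠ []) : OrderLE (-1) (mapCoeff (T w) (Lax K u)) := by
  intro i hi
  rw [mapCoeff_apply, Lax]
  change T w (if i = 1 then 1 else if i < 0 then u (-1 - i).toNat else 0) = 0
  rw [if_neg (by omega : ¬ i < 0)]
  split_ifs
  · rw [h.map_one]
    cases w with
    | nil => exact absurd rfl hw
    | cons m w => rfl
  · exact map_zero _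

theorem map_flow_potential {φ : A} (hφ : d φ = u 0) {w : List ℕ+} (hw : w ≠ []) :
    d (T w φ) = d (Phi d u (P K w)) := by
  have h1 := congrFun (congrArg Subtype.val (h.lax w hw)) (-1)
  rw [laxRHS_apply h.leibniz (fun v hv _ => h.orderLE_flow hv) le_rfl, mapCoeff_apply,
    lax_apply_neg_one, neg_apply, if_pos (by norm_num)] at h1
  rw [← h.comm, hφ, h1]
  rfl

/-- The elements of ℛ whose flows all stay in ℛ form a subspace closed under the generating
operations. It contains L by induction on the length, and ∂^{-1} because its flows vanish for
nonempty words. -/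
theorem mapCoeff_mem {X : PsiDO K A} (hX : X ∈ OpAlg d u) (w : List ℕ+) :
    mapCoeff (T w) X ∈ OpAlg d u := by
  let S : Submodule K (PsiDO K A) :=
    OpAlg d u ⊓ ⨅ w, (OpAlg d u).comap (mapCoeff (T w))
  have hS : ∀ Y, Y ∈ S ↔ Y ∈ OpAlg d u ∧ ∀ w, mapCoeff (T w) Y ∈ OpAlg d u := fun Y => by
    simp [S, Submodule.mem_inf, Submodule.mem_iInf]
  have hone : monomial (-1) 1 ∈ OpAlg d u := (Submodule.mem_sInf).2 fun _ hS => hS.2.1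
  have hle : OpAlg d u ≤ S := by
    refine sInf_le ⟨?_, ?_, fun Y hY Z hZ => ?_, fun Y hY => ?_⟩
    · rw [hS]
      refine ⟨lax_mem d u, fun w => ?_⟩
      induction hk : w.length using Nat.strong_induction_on generalizing w with
      | _ k ih =>
        by_cases hw : w = []
        · rw [hw, h.nil]
          exact lax_mem d u
        · have hn : ∀ v, neg (ell d u (P K v)) ∈ OpAlg d u := fun v => neg_mem d u (ell_mem d u _)
          rw [h.lax w hw, laxRHS]
          refine Submodule.add_mem _ (Submodule.neg_mem _ (Submodule.sub_mem _
            (mul_mem d u (hn _) (lax_mem d u)) (mul_mem d u (lax_mem d u) (hn _))))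
            (Submodule.sum_mem _ fun j hj => mul_mem d u ?_ (hn _))
          rw [Finset.mem_Ico] at hj
          exact ih j (by omega) _ (by rw [List.length_take]; omega)
    · rw [hS]
      refine ⟨hone, fun w => ?_⟩
      rw [mapCoeff_monomial, h.map_one]
      cases w with
      | nil => exact hone
      | cons m w =>
        rw [Series.one_cons, map_zero]
        exact Submodule.zero_mem _
    · rw [hS] at hY hZ ⊢
      refine ⟨mul_mem d u hY.1 hZ.1, fun w => ?_⟩
      rw [mapCoeff_mul _ (T w) (fun j => T (w.take j)) (fun j => T (w.drop j)) (h.mul w)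
        fun j => h.comm _]
      exact Submodule.sum_mem _ fun j _ => mul_mem d u (hY.2 _) (hZ.2 _)
    · rw [hS] at hY ⊢
      refine ⟨pos_mem d u hY.1, fun w => ?_⟩
      rw [mapCoeff_pos]
      exact pos_mem d u (hY.2 w)
  exact ((hS X).1 (hle hX)).2 w

omit h in
/-- The generalized derivations of `ℛ` given by a solution of the hierarchy. -/
noncomputable def delta (h : IsHierarchySolution d u T) (w : List ℕ+) :
    Module.End K (OpAlg d u) :=
  (mapCoeff (T w)).restrict fun _ hX => h.mapCoeff_mem hX w

theorem delta_apply (w : List ℕ+) (X : OpAlg d u) : (h.delta w X).1 = mapCoeff (T w) X.1 := rfl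

theorem isDelta_delta : IsDelta d u h.delta where
  nil := by
    ext1 X
    refine Subtype.ext ?_
    rw [h.delta_apply, h.nil]
    rfl
  lax w hw := h.lax w hw
  pos w X := Subtype.ext (mapCoeff_pos (T w) X.1)
  mul w X Y := by
    refine Subtype.ext ?_
    rw [Submodule.coe_sum]
    exact mapCoeff_mul _ (T w) (fun j => T (w.take j)) (fun j => T (w.drop j)) (h.mul w)
      (fun j => h.comm _) X.1 Y.1

theorem delta_opPhi {w : List ℕ+} (hw : w ≠ []) (α : AP K) :
    h.delta w (opPhi d u α) = opPhi d u (circ K (P K w) α) := by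
  refine Subtype.ext ?_
  rw [h.delta_apply]
  change mapCoeff (T w) (monomial 0 (Phi d u α)) = monomial 0 (Phi d u (circ K (P K w) α))
  rw [mapCoeff_monomial, h.flow_Phi hw]

end IsHierarchySolution

/-! ## Uniqueness of the generalized derivations -/

/-- No value on ∂^{-1} is prescribed: multiplicativity forces it, as the inverse of the value on ∂ =
L_{≥0}. -/
theorem isDelta_unique (hd : ∀ a b, d (a * b) = d a * b + a * d b)
    {δ δ' : List ℕ+ → Module.End K (OpAlg d u)} (h : IsDelta d u δ) (h' : IsDelta d u δ') :
    δ' = δ := by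
  let _ := psiRing hd
  let H : (List ℕ+ → Module.End K (OpAlg d u)) → OpAlg d u → Series (PsiDO K A) :=
    fun δ X w => (δ w X).1
  have Hmul : ∀ δ, IsDelta d u δ → ∀ X Y, H δ (opMul d u X Y) = H δ X * H δ Y := by
    intro δ h X Y
    ext1 w
    change (δ w (opMul d u X Y)).1 = _
    rw [h.mul, Submodule.coe_sum]
    rfl
  have hinv : monomial (-1) 1 ∈ OpAlg d u := (Submodule.mem_sInf).2 fun _ hS => hS.2.1
  set D : OpAlg d u := opPos d u (opLax d u) with hD
  set I : OpAlg d u := ⟨monomial (-1) 1, hinv⟩ with hI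
  have hD1 : D.1 = monomial 1 1 := pos_lax u
  have hID : (opMul d u I D).1 = monomial 0 1 := by
    change mul d (monomial (-1) 1) D.1 = _
    rw [hD1, monomial_one_mul_monomial_one hd]
    rfl
  have hDI : opMul d u D I = opMul d u I D := by
    refine Subtype.ext ?_
    rw [hID]
    change mul d D.1 (monomial (-1) 1) = _
    rw [hD1, monomial_one_mul_monomial_one hd]
    rfl
  -- The unit of ℛ is ∂^{-1} ∂; its image is idempotent with constant term 1.
  have Hone : ∀ δ, IsDelta d u δ → H δ (opMul d u I D) = 1 := by
    intro δ h
    refine Series.eq_one_of_mul_self ?_ ?_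
    · rw [← Hmul δ h]
      congr 1
      refine Subtype.ext ?_
      change mul d (opMul d u I D).1 (opMul d u I D).1 = (opMul d u I D).1
      rw [hID, monomial_zero_one_mul]
    · change (δ [] (opMul d u I D)).1 = monomial 0 1
      rw [h.nil, ← hID]
      rfl
  have hlax : H δ (opLax d u) = H δ' (opLax d u) := by
    ext1 w
    induction hk : w.length using Nat.strong_induction_on generalizing w with
    | _ k ih =>
      change (δ w (opLax d u)).1 = (δ' w (opLax d u)).1
      by_cases hw : w = []
      · rw [hw, h.nil, h'.nil]
      · rw [h.lax w hw, h'.lax w hw]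
        exact laxRHS_congr fun v hv => ih v.length (by omega) v rfl
  have hpos : ∀ X, H δ X = H δ' X → H δ (opPos d u X) = H δ' (opPos d u X) := by
    intro X hX
    ext1 w
    change (δ w (opPos d u X)).1 = (δ' w (opPos d u X)).1
    rw [h.pos, h'.pos]
    exact congrArg NCKP.pos (congrFun hX w)
  have hI' : H δ I = H δ' I := by
    -- One family supplies a left inverse, the other a right inverse, of the common value on ∂.
    refine left_inv_eq_right_inv (a := H δ D) ?_ ?_
    · rw [← Hmul δ h, Hone δ h]
    · rw [hpos _ hlax, ← Hmul δ' h', hDI, Hone δ' h']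
  let S : Submodule K (PsiDO K A) :=
    { carrier := {X | ∃ hX : X ∈ OpAlg d u, H δ ⟨X, hX⟩ = H δ' ⟨X, hX⟩}
      zero_mem' := ⟨Submodule.zero_mem _, by
        ext1 w
        change (δ w 0).1 = (δ' w 0).1
        rw [map_zero, map_zero]⟩
      add_mem' := by
        rintro X Y ⟨hX, hX'⟩ ⟨hY, hY'⟩
        refine ⟨Submodule.add_mem _ hX hY, ?_⟩
        ext1 w
        change (δ w (⟨X, hX⟩ + ⟨Y, hY⟩)).1 = (δ' w (⟨X, hX⟩ + ⟨Y, hY⟩)).1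
        rw [map_add, map_add]
        exact congrArg₂ (· + ·) (congrFun hX' w) (congrFun hY' w)
      smul_mem' := by
        rintro c X ⟨hX, hX'⟩
        refine ⟨Submodule.smul_mem _ c hX, ?_⟩
        ext1 w
        change (δ w (c • ⟨X, hX⟩)).1 = (δ' w (c • ⟨X, hX⟩)).1
        rw [map_smul, map_smul]
        exact congrArg (c • ·) (congrFun hX' w) }
  have hle : OpAlg d u ≤ S := by
    refine sInf_le ⟨⟨lax_mem d u, hlax⟩, ⟨hinv, hI'⟩, ?_, ?_⟩
    · rintro X ⟨hX, hX'⟩ Y ⟨hY, hY'⟩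
      refine ⟨mul_mem d u hX hY, ?_⟩
      have h1 := Hmul δ h ⟨X, hX⟩ ⟨Y, hY⟩
      rw [hX', hY', ← Hmul δ' h'] at h1
      exact h1
    · rintro X ⟨hX, hX'⟩
      exact ⟨pos_mem d u hX, hpos _ hX'⟩
  funext w
  ext1 X
  obtain ⟨_, hX⟩ := hle X.2
  exact Subtype.ext (congrFun hX w).symm

/-! ## The flows of `L` -/

variable (d u) in
/-- The right-hand sides of the Lax equations, computed recursively. -/
noncomputable def laxFlow : List ℕ+ → PsiDO K A :=
  (measure (List.length : List ℕ+ → ℕ)).wf.fix fun w rec =>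
    if w = [] then Lax K u
    else laxRHS d u (fun v => if h : v.length < w.length then rec v h else 0) w

theorem laxFlow_nil : laxFlow d u [] = Lax K u := by
  rw [laxFlow, WellFounded.fix_eq, if_pos rfl]

theorem laxFlow_eq {w : List ℕ+} (hw : w ≠ []) :
    laxFlow d u w = laxRHS d u (laxFlow d u) w := by
  rw [laxFlow, WellFounded.fix_eq, if_neg hw]
  exact laxRHS_congr fun v hv => dif_pos hv

/-- Needed for consistency: L has only the u_n as free coefficients, so its flows may have no
nonnegative powers. -/
theorem orderLE_laxFlow (hd : ∀ a b, d (a * b) = d a * b + a * d b) {w : List ℕ+} (hw : w ≠ []) :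
    OrderLE (-1) (laxFlow d u w) := by
  induction hk : w.length using Nat.strong_induction_on generalizing w with
  | _ k ih =>
    intro n hn
    rw [laxFlow_eq hw, laxRHS_apply hd (fun v hv hlt => ih v.length (by omega) hv rfl) hn.le,
      neg_apply, if_neg (by omega), map_zero]

end Hierarchy

/-! ## The generic solution -/

section GenericSolution

variable (K : Type*) [Field K]

/-- The flows of the generators: `∑_w (∂_x^j ∂_{t_w} u_{k+2}) t_w`. -/
noncomputable def genericGen (p : ℕ × ℕ) : Series (DiffPoly K) :=
  fun w => (dx K ^ p.2) ((laxFlow (dx K) (genericU K) w).1 (-1 - p.1))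

/-- `f ↦ ∑_w (∂_{t_w} f) t_w` on differential polynomials. -/
noncomputable def genericHom : DiffPoly K →ₐ[K] Series (DiffPoly K) :=
  FreeAlgebra.lift K (genericGen K)

/-- The flows `∂_{t_w}` on differential polynomials. -/
noncomputable def genericFlow (w : List ℕ+) : DiffPoly K →ₗ[K] DiffPoly K where
  toFun f := genericHom K f w
  map_add' f g := by rw [map_add, Series.add_apply]
  map_smul' c f := by rw [map_smul, Series.smul_apply]; rfl

theorem genericFlow_apply (w : List ℕ+) (f : DiffPoly K) :
    genericFlow K w f = genericHom K f w := rfl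

theorem genericFlow_ι (w : List ℕ+) (k j : ℕ) : genericFlow K w (FreeAlgebra.ι K (k, j)) =
    (dx K ^ j) ((laxFlow (dx K) (genericU K) w).1 (-1 - k)) := by
  rw [genericFlow_apply, genericHom, FreeAlgebra.lift_ι_apply]
  rfl

theorem genericFlow_mul (w : List ℕ+) (f g : DiffPoly K) : genericFlow K w (f * g) =
    ∑ j ∈ Finset.range (w.length + 1), genericFlow K (w.take j) f * genericFlow K (w.drop j) g := by
  rw [genericFlow_apply, map_mul]
  rfl

theorem genericFlow_one (w : List ℕ+) : genericFlow K w 1 = (1 : Series (DiffPoly K)) w := by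
  rw [genericFlow_apply, map_one]

theorem dx_pow_ι (k j : ℕ) :
    (dx K ^ j) (FreeAlgebra.ι K (k, 0)) = FreeAlgebra.ι K (k, j) := by
  induction j with
  | zero => rfl
  | succ j ih => rw [pow_succ', Module.End.mul_apply, ih, dx_gen]

theorem lax_genericU_apply (k : ℕ) :
    (Lax K (genericU K)).1 (-1 - k) = FreeAlgebra.ι K (k, 0) := by
  change (if (-1 - k : ℤ) = 1 then 1 else if (-1 - k : ℤ) < 0 then
    genericU K (-1 - (-1 - k : ℤ)).toNat else 0) = _
  rw [if_neg (by omega), if_pos (by omega), show (-1 - (-1 - k : ℤ)).toNat = k by omega]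
  rfl

theorem genericFlow_nil : genericFlow K [] = LinearMap.id := by
  have h : AlgHom.ofLinearMap (genericFlow K []) (by rw [genericFlow_one]; rfl)
      (fun f g => by rw [genericFlow_apply, map_mul, Series.mul_nil]; rfl) =
        AlgHom.id K (DiffPoly K) := by
    refine FreeAlgebra.hom_ext (funext fun ⟨k, j⟩ => ?_)
    change genericFlow K [] (FreeAlgebra.ι K (k, j)) = FreeAlgebra.ι K (k, j)
    rw [genericFlow_ι, laxFlow_nil, lax_genericU_apply, dx_pow_ι]
  ext1 f
  exact DFunLike.congr_fun h f

/-- Built into the values on the generators; it passes to products since ∂_x is a derivation. -/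
theorem genericFlow_dx (w : List ℕ+) (f : DiffPoly K) :
    genericFlow K w (dx K f) = dx K (genericFlow K w f) := by
  have h1 : dx K 1 = 0 := map_one_eq_zero (dx_mul K)
  induction f using FreeAlgebra.induction generalizing w with
  | grade0 r =>
    rw [Algebra.algebraMap_eq_smul_one, map_smul, map_smul, map_smul, map_smul, h1,
      genericFlow_one, map_zero]
    cases w with
    | nil => rw [Series.one_nil, h1]
    | cons m w => rw [Series.one_cons, map_zero]
  | grade1 p =>
    obtain ⟨k, j⟩ := p
    rw [dx_gen, genericFlow_ι, genericFlow_ι, pow_succ', Module.End.mul_apply]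
  | mul f g hf hg =>
    rw [dx_mul, map_add, genericFlow_mul, genericFlow_mul, genericFlow_mul, map_sum,
      ← Finset.sum_add_distrib]
    exact Finset.sum_congr rfl fun j _ => by rw [dx_mul, hf, hg]
  | add f g hf hg => rw [map_add, map_add, map_add, map_add, hf, hg]

theorem mapCoeff_genericFlow (w : List ℕ+) :
    mapCoeff (genericFlow K w) (Lax K (genericU K)) = laxFlow (dx K) (genericU K) w := by
  by_cases hw : w = []
  · rw [hw, genericFlow_nil, laxFlow_nil]
    rfl
  · refine Subtype.ext (funext fun i => ?_)
    by_cases hi : i < 0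
    -- The coefficient of ∂^{-1-k} is the generator standing for u_{k+2}.
    · obtain ⟨k, rfl⟩ : ∃ k : ℕ, i = -1 - k := ⟨(-1 - i).toNat, by omega⟩
      rw [mapCoeff_apply, lax_genericU_apply, genericFlow_ι, pow_zero]
      rfl
    · rw [orderLE_laxFlow (dx_mul K) hw i (by omega), mapCoeff_apply]
      change genericFlow K w (if i = 1 then 1 else if i < 0 then _ else 0) = 0
      rw [if_neg hi]
      split_ifs
      · rw [genericFlow_one]
        cases w with
        | nil => exact absurd rfl hw
        | cons m w => rfl
      · exact map_zero _

theorem isHierarchySolution_genericFlow :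
    IsHierarchySolution (dx K) (genericU K) (genericFlow K) where
  leibniz := dx_mul K
  nil := genericFlow_nil K
  comm := genericFlow_dx K
  mul := genericFlow_mul K
  lax w hw := by
    simp only [mapCoeff_genericFlow]
    exact laxFlow_eq hw

end GenericSolution

end NCKP

theorem proposition6p5 (K : Type*) [Field K] [CharZero K] :
    -- the generic operator `L`: there is exactly one family of generalized derivations, and
    -- `δ_{m₁…m_k} Φ(α) = Φ(P_{m₁…m_k} ∘ α)`
    (∃ δ : List ℕ+ → Module.End K (NCKP.OpAlg (NCKP.dx K) (NCKP.genericU K)),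
      NCKP.IsDelta (NCKP.dx K) (NCKP.genericU K) δ ∧
      (∀ δ', NCKP.IsDelta (NCKP.dx K) (NCKP.genericU K) δ' → δ' = δ) ∧
      ∀ w : List ℕ+, w ≠ [] → ∀ α : NCKP.AP K,
        δ w (NCKP.opPhi (NCKP.dx K) (NCKP.genericU K) α) =
          NCKP.opPhi (NCKP.dx K) (NCKP.genericU K) (NCKP.circ K (NCKP.P K w) α)) ∧
    -- the identification `δ = ∂_t` for solutions of the hierarchy, with potential `φ`, `φ_x = u₂`
    ∀ (A : Type*) [Ring A] [Algebra K A] (d : A →ₗ[K] A) (u : ℕ → A)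
      (T : List ℕ+ → A →ₗ[K] A), NCKP.IsHierarchySolution d u T →
      (∀ w : List ℕ+, w ≠ [] → ∀ α : NCKP.AP K,
        T w (NCKP.Phi d u α) = NCKP.Phi d u (NCKP.circ K (NCKP.P K w) α)) ∧
      ∀ φ : A, d φ = u 0 →
        (∀ w : List ℕ+, w ≠ [] → d (T w φ) = d (NCKP.Phi d u (NCKP.P K w))) ∧
        (∀ v w : List ℕ+, v ≠ [] → w ≠ [] →
          d (T v (T w φ)) = d (NCKP.Phi d u (NCKP.circ K (NCKP.P K v) (NCKP.P K w)))) ∧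
        ((∀ w : List ℕ+, w ≠ [] → T w φ = NCKP.Phi d u (NCKP.P K w)) →
          ∀ v w : List ℕ+, v ≠ [] → w ≠ [] →
            T v (T w φ) = NCKP.Phi d u (NCKP.circ K (NCKP.P K v) (NCKP.P K w))) := by
  refine ⟨?_, fun A _ _ d u T h => ⟨fun w hw α => h.flow_Phi hw α, fun φ hφ =>
    ⟨fun w hw => h.map_flow_potential hφ hw, fun v w hv hw => ?_, fun hT v w hv hw => ?_⟩⟩⟩
  · have h := NCKP.isHierarchySolution_genericFlow K
    exact ⟨h.delta, h.isDelta_delta,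
      fun δ' h' => NCKP.isDelta_unique (NCKP.dx_mul K) h.isDelta_delta h', fun w hw α => h.delta_opPhi hw α⟩
  · rw [← h.comm, h.map_flow_potential hφ hw, h.comm, h.flow_Phi hv]
  · rw [hT w hw, h.flow_Phi hv]
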